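/- Let $K$ be a commutative ring, $B$ an associative unital $K$-algebra, $d\ge 2$, and let $S,R\in B\otimes B$ and $\sigma,\rho\in\operatorname{End}_K(B\otimes B)$ (all tensor products are over $K$). For $1\le i\le d-1$, $Z \in B\otimes B$, a $K$-module $V$ and $\phi\in\operatorname{End}_K(V\otimes V)$, put $Z_i=1^{\otimes i-1}\otimes Z\otimes 1^{\otimes d-i-1}\in B^{\otimes d}$ and let $\phi_i\in\operatorname{End}_K(V^{\otimes d})$ apply $\phi$ to the $i$-th and $(i+1)$-st tensor factors. Let $B\wr\mathcal H(d)$ be the quantum wreath product: the $K$-algebra generated by the algebra $B^{\otimes d}$ and symbols $H_1,\dots,H_{d-1}$ with relations $H_kH_{k+1}H_k=H_{k+1}H_kH_{k+1}$, $H_iH_j=H_jH_i$ for $|i-j|\ge2$, $H_i^2=S_iH_i+R_i$, and $H_ib=\sigma_i(b)H_i+\rho_i(b)$ for $b\in B^{\otimes d}$. For $w\in\Sigma_d$ let $H_w=H_{i_1}\cdots H_{i_N}$ for a reduced expression $w=s_{i_1}\cdots s_{i_N}$ in the simple transpositions. Assume that $B\wr\mathcal H(d)$ has a PBW basis, i.e.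 for a $K$-basis $(b_i)_{i\in I}$ of $B$ the elements $(b_{i_1}\otimes\dots\otimes b_{i_d})H_w$ with $i_j\in I$, $w\in\Sigma_d$ form a $K$-basis of $B\wr\mathcal H(d)$. Let $M$ be a left $B$-module, $\sigma^M,\rho^M\in\operatorname{End}_K(M\otimes M)$, and let $S^M,R^M$ be multiplication on $M\otimes M$ by scalars $\chi(S),\chi(R)\in K$. Let $\widetilde{\mathcal H}$ be the twisted Hecke algebra, i.e. the quantum wreath product $K\wr\mathcal H(d)$ with $\sigma=\mathrm{id}$, $\rho=0$, $S=\chi(S)$, $R=\chi(R)$, with generators $h_i$, so that $h_i^2=\chi(S)h_i+\chi(R)$. Write $\mathcal B=B^{\otimes d}$, $\mathcal M=M^{\otimes d}$, let $\alpha_M:\mathcal B\otimes\mathcal M\to\mathcal M$ be the factorwise action and let $W$ be the free $K$-module on $\Sigma_d$. Let $\tau^B:W\otimes\mathcal B\to\mathcal B\otimes W$ and $m_W:W\otimes W\to\mathcal B\otimes W$ be given by $\tau^B(w\otimes b)=\sum_g b_g\otimes g$ if $H_wb=\sum_g b_gH_g$, and $m_W(w\otimes x)=\sum_g b_g\otimes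 g$ if $H_wH_x=\sum_g b_gH_g$. Let $r$ be a compatible choice of expressions: $r(1)$ is empty, and each $w\neq1$ has $r(w)=s_i\,r(x)$ for some $i$ and $x$ with $w=s_ix>x$. The structure map $\tau^M=\tau^M(r):W\otimes\mathcal M\to\mathcal M\otimes\widetilde{\mathcal H}$ is defined by $\tau^M(1\otimes m)=m\otimes1$, $\tau^M(s_i\otimes m)=\sigma^M_i(m)\otimes h_i+\rho^M_i(m)\otimes1$, and recursively $\tau^M(w\otimes m)=(\mathbb 1\otimes\mu)(\tau^M\otimes\mathbb 1)(s_i\otimes\tau^M(s_iw\otimes m))$ if $r(w)=s_ir(s_iw)$, where $\mu$ is the multiplication of $\widetilde{\mathcal H}$. The tuple $(M,\sigma^M,\rho^M,S^M,R^M)$ is called a ground module if $\tau^M(r)$ is independent of the choice of $r$ and the following two diagrams commute: (WB) $\ \tau^M\circ(\mathbb 1\otimes\alpha_M)=(\alpha_M\otimes\mathbb 1)\circ(\mathbb 1\otimes\tau^M)\circ(\tau^B\otimes\mathbb 1)$ as maps $W\otimes\mathcal B\otimes\mathcal M\to\mathcal M\otimes\widetilde{\mathcal H}$; (WW) $\ (\mathbb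 1\otimes\mu)\circ(\tau^M\otimes\mathbb 1)\circ(\mathbb 1\otimes\tau^M)=(\alpha_M\otimes\mathbb 1)\circ(\mathbb 1\otimes\tau^M)\circ(m_W\otimes\mathbb 1)$ as maps $W\otimes W\otimes\mathcal M\to\mathcal M\otimes\widetilde{\mathcal H}$. Theorem. $(M,\sigma^M,\rho^M,S^M,R^M)$ is a ground module if and only if (M2) and (M4) hold for all $1\le i\le d-1$, $b\in\mathcal B$, $m\in\mathcal M$ and, in case $d\ge3$, also (M5), (M6), (M7) hold for all $1\le i,j\le d-1$ with $|i-j|=1$, where, with $l^M_X$ the action of $X\in\mathcal B$ on $\mathcal M$: (M2) $\sigma^M_i(bm)=\sigma_i(b)\,\sigma^M_i(m)$ and $\rho^M_i(bm)=\sigma_i(b)\,\rho^M_i(m)+\rho_i(b)\,m$; (M4) $\chi(S)(\sigma^M_i)^2+\rho^M_i\sigma^M_i+\sigma^M_i\rho^M_i=l^M_{S_i}\sigma^M_i$ and $\chi(R)(\sigma^M_i)^2+(\rho^M_i)^2=l^M_{S_i}\rho^M_i+l^M_{R_i}$; (M5) $\sigma^M_i\sigma^M_j\sigma^M_i=\sigma^M_j\sigma^M_i\sigma^M_j$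 and $\rho^M_i\sigma^M_j\sigma^M_i=\sigma^M_j\sigma^M_i\rho^M_j$; (M6) $\rho^M_i\sigma^M_j\rho^M_i=\chi(S)\,\sigma^M_j\rho^M_i\sigma^M_j+\rho^M_j\rho^M_i\sigma^M_j+\sigma^M_j\rho^M_i\rho^M_j$; (M7) $\rho^M_i\rho^M_j\rho^M_i+\chi(R)\,\sigma^M_i\rho^M_j\sigma^M_i=\rho^M_j\rho^M_i\rho^M_j+\chi(R)\,\sigma^M_j\rho^M_i\sigma^M_j$. -/

import Mathlib

open scoped TensorProduct

noncomputable section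

namespace QuantumWreath

/-! ### Local operators on tensor powers -/

section Local

variable {d : ℕ}

/-- The first of the two adjacent tensor positions numbered by `i`. -/
def lo (i : Fin (d - 1)) : Fin d := ⟨i.1, by omega⟩

/-- The second of the two adjacent tensor positions numbered by `i`. -/
def hi (i : Fin (d - 1)) : Fin d := ⟨i.1 + 1, by omega⟩

theorem lo_ne_hi (i : Fin (d - 1)) : lo i ≠ hi i := by
  intro h
  have := congrArg Fin.val h
  simp [lo, hi] at this

variable (K : Type*) [CommRing K] {V : Type*} [AddCommGroup V] [Module K V]

/-- The `d`-th tensor power of `V` over `K`. -/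
abbrev TPow (d : ℕ) (V : Type*) [AddCommGroup V] [Module K V] : Type _ := ⨂[K] _ : Fin d, V

variable {K}

/-- `a ⊗ b ↦ v₁ ⊗ ⋯ ⊗ a ⊗ b ⊗ ⋯ ⊗ v_d`, with `a`, `b` in the positions `lo i`, `hi i`. -/
def pairAt (i : Fin (d - 1)) (v : Fin d → V) : V ⊗[K] V →ₗ[K] TPow K d V :=
  TensorProduct.lift
    (LinearMap.mk₂ K
      (fun a b => PiTensorProduct.tprod K (Function.update (Function.update v (lo i) a) (hi i) b))
      (by
        intro a a' b
        simp only [Function.update_comm (lo_ne_hi i)]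
        exact (PiTensorProduct.tprod K).map_update_add _ _ _ _)
      (by
        intro c a b
        simp only [Function.update_comm (lo_ne_hi i)]
        exact (PiTensorProduct.tprod K).map_update_smul _ _ _ _)
      (fun a b b' => (PiTensorProduct.tprod K).map_update_add _ _ _ _)
      (fun c a b => (PiTensorProduct.tprod K).map_update_smul _ _ _ _))

theorem pairAt_tmul (i : Fin (d - 1)) (v : Fin d → V) (a b : V) :
    pairAt (K := K) i v (a ⊗ₜ b)
      = PiTensorProduct.tprod K (Function.update (Function.update v (lo i) a) (hi i) b) := by
  simp [pairAt]

theorem pairAt_update_lo (i : Fin (d - 1)) (v : Fin d → V) (x : V) :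
    pairAt (K := K) i (Function.update v (lo i) x) = pairAt i v := by
  apply TensorProduct.ext'
  intro a b
  simp [pairAt_tmul]

theorem pairAt_update_hi (i : Fin (d - 1)) (v : Fin d → V) (x : V) :
    pairAt (K := K) i (Function.update v (hi i) x) = pairAt i v := by
  apply TensorProduct.ext'
  intro a b
  simp [pairAt_tmul, Function.update_comm (lo_ne_hi i)]

theorem pairAt_update_add (i : Fin (d - 1)) (v : Fin d → V) (k : Fin d)
    (hlo : k ≠ lo i) (hhi : k ≠ hi i) (x y : V) :
    pairAt (K := K) i (Function.update v k (x + y))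
      = pairAt i (Function.update v k x) + pairAt i (Function.update v k y) := by
  apply TensorProduct.ext'
  intro a b
  simp only [pairAt_tmul, LinearMap.add_apply, Function.update_comm hlo, Function.update_comm hhi]
  exact (PiTensorProduct.tprod K).map_update_add _ _ _ _

theorem pairAt_update_smul (i : Fin (d - 1)) (v : Fin d → V) (k : Fin d)
    (hlo : k ≠ lo i) (hhi : k ≠ hi i) (c : K) (x : V) :
    pairAt (K := K) i (Function.update v k (c • x)) = c • pairAt i (Function.update v k x) := by
  apply TensorProduct.ext'
  intro a b
  simp only [pairAt_tmul, LinearMap.smul_apply, Function.update_comm hlo, Function.update_comm hhi]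
  exact (PiTensorProduct.tprod K).map_update_smul _ _ _ _

/-- The operator `φ_i` on `V^{⊗ d}`: apply `φ : V ⊗ V → V ⊗ V` in the two adjacent positions
numbered by `i`, that is
`φ_i (v₁ ⊗ ⋯ ⊗ v_d) = v₁ ⊗ ⋯ ⊗ φ (v_i ⊗ v_{i+1}) ⊗ ⋯ ⊗ v_d`. -/
def locEnd (i : Fin (d - 1)) (φ : Module.End K (V ⊗[K] V)) : Module.End K (TPow K d V) :=
  PiTensorProduct.lift
    (MultilinearMap.mk' (fun v => pairAt i v (φ (v (lo i) ⊗ₜ v (hi i))))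
      (by
        intro v k x y
        by_cases hlo : k = lo i
        · subst hlo
          simp [pairAt_update_lo, Function.update_of_ne (lo_ne_hi i).symm, TensorProduct.add_tmul]
        by_cases hhi : k = hi i
        · subst hhi
          simp [pairAt_update_hi, Function.update_of_ne (lo_ne_hi i), TensorProduct.tmul_add]
        simp [Function.update_of_ne (Ne.symm hlo), Function.update_of_ne (Ne.symm hhi),
          pairAt_update_add i v k hlo hhi])
      (by
        intro v k c x
        by_cases hlo : k = lo i
        · subst hlo
          simp [pairAt_update_lo, Function.update_of_ne (lo_ne_hi i).symm,
            ← TensorProduct.smul_tmul']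
        by_cases hhi : k = hi i
        · subst hhi
          simp [pairAt_update_hi, Function.update_of_ne (lo_ne_hi i)]
        simp [Function.update_of_ne (Ne.symm hlo), Function.update_of_ne (Ne.symm hhi),
          pairAt_update_smul i v k hlo hhi]))

theorem locEnd_tprod (i : Fin (d - 1)) (φ : Module.End K (V ⊗[K] V)) (v : Fin d → V) :
    locEnd i φ (PiTensorProduct.tprod K v) = pairAt i v (φ (v (lo i) ⊗ₜ v (hi i))) := by
  simp [locEnd]

/-- The element `Z_i = 1 ⊗ ⋯ ⊗ Z ⊗ ⋯ ⊗ 1` of `B^{⊗ d}` for `Z ∈ B ⊗ B`. -/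
def locElt {B : Type*} [Ring B] [Algebra K B] (i : Fin (d - 1)) (Z : B ⊗[K] B) : TPow K d B :=
  pairAt i (fun _ => 1) Z

end Local

/-! ### Simple transpositions and reduced expressions in the symmetric group -/

section Sym

variable {d : ℕ}

/-- The simple transposition `s_i`. -/
def simple (i : Fin (d - 1)) : Equiv.Perm (Fin d) := Equiv.swap (lo i) (hi i)

/-- The product `s_{i₁} ⋯ s_{i_N}` of a word. -/
def wordProd (L : List (Fin (d - 1))) : Equiv.Perm (Fin d) := (L.map simple).prod

theorem exists_word (w : Equiv.Perm (Fin d)) : ∃ L : List (Fin (d - 1)), wordProd L = w := by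
  cases d with
  | zero => exact ⟨[], Subsingleton.elim _ _⟩
  | succ n =>
    have hw : w ∈ Submonoid.closure
        (Set.range fun i : Fin n => Equiv.swap i.castSucc i.succ) := by
      rw [Equiv.Perm.mclosure_swap_castSucc_succ]
      trivial
    induction hw using Submonoid.closure_induction with
    | mem x hx =>
      obtain ⟨i, rfl⟩ := hx
      exact ⟨[i], by simp [wordProd, simple]; rfl⟩
    | one => exact ⟨[], rfl⟩
    | mul x y _ _ hx hy =>
      obtain ⟨L, rfl⟩ := hx
      obtain ⟨L', rfl⟩ := hy
      exact ⟨L ++ L', by simp [wordProd]⟩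

/-- The length of `w`: the least number of simple transpositions with product `w`. -/
def len (w : Equiv.Perm (Fin d)) : ℕ :=
  sInf {n | ∃ L : List (Fin (d - 1)), wordProd L = w ∧ L.length = n}

/-- `L` is a reduced expression of `w`. -/
def IsReducedExpr (w : Equiv.Perm (Fin d)) (L : List (Fin (d - 1))) : Prop :=
  wordProd L = w ∧ L.length = len w

theorem exists_reducedExpr (w : Equiv.Perm (Fin d)) : ∃ L, IsReducedExpr w L := by
  have hne : {n | ∃ L : List (Fin (d - 1)), wordProd L = w ∧ L.length = n}.Nonempty := by
    obtain ⟨L, hL⟩ := exists_word w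
    exact ⟨_, L, hL, rfl⟩
  exact Nat.sInf_mem hne

/-- A reduced expression of `w`. -/
def reducedExpr (w : Equiv.Perm (Fin d)) : List (Fin (d - 1)) :=
  Classical.choose (exists_reducedExpr w)

/-- A compatible choice `r` of an expression for every permutation: `r 1` is empty and, for
`w ≠ 1`, there are `i` and `x` with `w = s_i x > x` and `r w = s_i (r x)`. -/
structure ChoiceMap (d : ℕ) where
  /-- the chosen expression -/
  r : Equiv.Perm (Fin d) → List (Fin (d - 1))
  r_one : r 1 = []
  r_step : ∀ w, w ≠ 1 → ∃ i x, w = simple i * x ∧ len x < len w ∧ r w = i :: r x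

end Sym

/-! ### Quantum wreath products -/

/-- A choice of parameters `R, S ∈ B ⊗ B` and `ρ, σ ∈ End_K (B ⊗ B)`. -/
structure Params (K B : Type*) [CommRing K] [Ring B] [Algebra K B] where
  /-- the linear coefficient of the quadratic relation -/
  S : B ⊗[K] B
  /-- the constant coefficient of the quadratic relation -/
  R : B ⊗[K] B
  /-- the leading coefficient of the wreath relation -/
  σ : Module.End K (B ⊗[K] B)
  /-- the lower coefficient of the wreath relation -/
  ρ : Module.End K (B ⊗[K] B)

section QWP

variable {K B : Type*} [CommRing K] [Ring B] [Algebra K B]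

/-- The free algebra on the elements of `B^{⊗ d}` and the symbols `H_i`. -/
abbrev Pre (K B : Type*) [CommRing K] [Ring B] [Algebra K B] (d : ℕ) : Type _ :=
  FreeAlgebra K (TPow K d B ⊕ Fin (d - 1))

/-- The generator of the free algebra given by `b ∈ B^{⊗ d}`. -/
def preB {d : ℕ} (b : TPow K d B) : Pre K B d := FreeAlgebra.ι K (Sum.inl b)

/-- The generator `H_i` of the free algebra. -/
def preH {d : ℕ} (i : Fin (d - 1)) : Pre K B d := FreeAlgebra.ι K (Sum.inr i)

/-- The defining relations: those of the algebra `B^{⊗ d}`, then the braid relations, the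
quadratic relations and the wreath relations. -/
inductive Rel (Q : Params K B) (d : ℕ) : Pre K B d → Pre K B d → Prop
  | add (a b : TPow K d B) : Rel Q d (preB (a + b)) (preB a + preB b)
  | mul (a b : TPow K d B) : Rel Q d (preB (a * b)) (preB a * preB b)
  | scalar (c : K) : Rel Q d (preB (algebraMap K (TPow K d B) c)) (algebraMap K (Pre K B d) c)
  | braid (i j : Fin (d - 1)) (h : (i : ℕ) + 1 = j) :
      Rel Q d (preH i * preH j * preH i) (preH j * preH i * preH j)
  | comm (i j : Fin (d - 1)) (h : (i : ℕ) + 2 ≤ j ∨ (j : ℕ) + 2 ≤ i) :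
      Rel Q d (preH i * preH j) (preH j * preH i)
  | quad (i : Fin (d - 1)) :
      Rel Q d (preH i * preH i) (preB (locElt i Q.S) * preH i + preB (locElt i Q.R))
  | wreath (i : Fin (d - 1)) (b : TPow K d B) :
      Rel Q d (preH i * preB b) (preB (locEnd i Q.σ b) * preH i + preB (locEnd i Q.ρ b))

/-- The quantum wreath product `B ≀_Q H(d)`. -/
def QWP (Q : Params K B) (d : ℕ) : Type _ := RingQuot (Rel Q d)

instance (Q : Params K B) (d : ℕ) : Ring (QWP Q d) := inferInstanceAs (Ring (RingQuot (Rel Q d)))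

instance (Q : Params K B) (d : ℕ) : Algebra K (QWP Q d) :=
  inferInstanceAs (Algebra K (RingQuot (Rel Q d)))

/-- The quotient map onto the quantum wreath product. -/
def quot (Q : Params K B) (d : ℕ) : Pre K B d →ₐ[K] QWP Q d := RingQuot.mkAlgHom K (Rel Q d)

/-- The structure map `B^{⊗ d} → B ≀ H(d)`. -/
def ofBase (Q : Params K B) (d : ℕ) : TPow K d B →ₐ[K] QWP Q d :=
  AlgHom.ofLinearMap
    { toFun := fun b => quot Q d (preB b)
      map_add' := fun a b => by
        rw [← map_add]
        exact RingQuot.mkAlgHom_rel K (Rel.add a b)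
      map_smul' := fun c b => by
        have h1 : quot Q d (preB (algebraMap K (TPow K d B) c * b))
            = quot Q d (preB (algebraMap K (TPow K d B) c) * preB b) :=
          RingQuot.mkAlgHom_rel K (Rel.mul _ b)
        have h2 : quot Q d (preB (algebraMap K (TPow K d B) c))
            = quot Q d (algebraMap K (Pre K B d) c) :=
          RingQuot.mkAlgHom_rel K (Rel.scalar c)
        rw [Algebra.smul_def, h1, map_mul, h2, AlgHom.commutes, RingHom.id_apply,
          Algebra.smul_def] }
    (by
      have h : quot Q d (preB (algebraMap K (TPow K d B) 1))
          = quot Q d (algebraMap K (Pre K B d) 1) :=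
        RingQuot.mkAlgHom_rel K (Rel.scalar 1)
      simpa using h)
    (by
      intro a b
      have h : quot Q d (preB (a * b)) = quot Q d (preB a * preB b) :=
        RingQuot.mkAlgHom_rel K (Rel.mul a b)
      simpa using h)

/-- The generator `H_i` of `B ≀ H(d)`. -/
def H (Q : Params K B) {d : ℕ} (i : Fin (d - 1)) : QWP Q d := quot Q d (preH i)

/-- `H_w = H_{i₁} ⋯ H_{i_N}` for a reduced expression `w = s_{i₁} ⋯ s_{i_N}`. -/
def HW (Q : Params K B) {d : ℕ} (w : Equiv.Perm (Fin d)) : QWP Q d :=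
  ((reducedExpr w).map (H Q)).prod

/-- The free `K`-module on the symmetric group. -/
abbrev W (K : Type*) [CommRing K] (d : ℕ) : Type _ := Equiv.Perm (Fin d) →₀ K

/-- The linear map `W → B ≀ H(d)`, `w ↦ H_w`. -/
def ofW (Q : Params K B) (d : ℕ) : W K d →ₗ[K] QWP Q d := Finsupp.linearCombination K (HW Q)

/-- The linear map `B^{⊗ d} ⊗ W → B ≀ H(d)`, `b ⊗ w ↦ b H_w`. -/
def normalForm (Q : Params K B) (d : ℕ) : TPow K d B ⊗[K] W K d →ₗ[K] QWP Q d :=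
  LinearMap.mul' K (QWP Q d) ∘ₗ TensorProduct.map (ofBase Q d).toLinearMap (ofW Q d)

end QWP

/-- `B ≀ H(d)` has a PBW basis: for some `K`-basis `(b_i)` of `B`, the elements
`(b_{i₁} ⊗ ⋯ ⊗ b_{i_d}) H_w` form a `K`-basis of `B ≀ H(d)`. -/
def HasPBWBasis.{u, v} {K : Type u} {B : Type v} [CommRing K] [Ring B] [Algebra K B]
    (Q : Params K B) (d : ℕ) : Prop :=
  ∃ (I : Type v) (b : Module.Basis I K B),
    LinearIndependent K (fun p : (Fin d → I) × Equiv.Perm (Fin d) =>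
      ofBase Q d (PiTensorProduct.tprod K fun j => b (p.1 j)) * HW Q p.2) ∧
    Submodule.span K (Set.range fun p : (Fin d → I) × Equiv.Perm (Fin d) =>
      ofBase Q d (PiTensorProduct.tprod K fun j => b (p.1 j)) * HW Q p.2) = ⊤

section PBW

variable {K B : Type*} [CommRing K] [Ring B] [Algebra K B]

theorem HasPBWBasis.bijective {Q : Params K B} {d : ℕ} (h : HasPBWBasis Q d) :
    Function.Bijective (normalForm Q d) := by
  obtain ⟨I, b, hli, hsp⟩ := h
  let c := (Basis.piTensorProduct fun _ : Fin d => b).tensorProduct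
    (Finsupp.basisSingleOne : Module.Basis (Equiv.Perm (Fin d)) K (W K d))
  let e := Module.Basis.mk hli hsp.ge
  have hE : normalForm Q d = (c.equiv e (Equiv.refl _)).toLinearMap := by
    apply c.ext
    intro p
    rw [LinearEquiv.coe_coe, Module.Basis.equiv_apply]
    obtain ⟨f, w⟩ := p
    simp only [c, e, Module.Basis.tensorProduct_apply, Basis.piTensorProduct_apply]
    simp [normalForm, ofW]
  rw [hE]
  exact (c.equiv e (Equiv.refl _)).bijective

/-- The identification of `B^{⊗ d} ⊗ W` with `B ≀ H(d)` given by a PBW basis. -/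
def pbwEquiv {Q : Params K B} {d : ℕ} (h : HasPBWBasis Q d) :
    (TPow K d B ⊗[K] W K d) ≃ₗ[K] QWP Q d :=
  LinearEquiv.ofBijective (normalForm Q d) h.bijective

/-- `τ^B : W ⊗ B^{⊗ d} → B^{⊗ d} ⊗ W`, sending `w ⊗ b` to `∑ b_g ⊗ g` where
`H_w b = ∑ b_g H_g`. -/
def tauB {Q : Params K B} {d : ℕ} (h : HasPBWBasis Q d) :
    W K d ⊗[K] TPow K d B →ₗ[K] TPow K d B ⊗[K] W K d :=
  (pbwEquiv h).symm.toLinearMap ∘ₗ LinearMap.mul' K (QWP Q d) ∘ₗ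
    TensorProduct.map (ofW Q d) (ofBase Q d).toLinearMap

/-- `m_W : W ⊗ W → B^{⊗ d} ⊗ W`, sending `w ⊗ x` to `∑ b_g ⊗ g` where
`H_w H_x = ∑ b_g H_g`. -/
def mulW {Q : Params K B} {d : ℕ} (h : HasPBWBasis Q d) :
    W K d ⊗[K] W K d →ₗ[K] TPow K d B ⊗[K] W K d :=
  (pbwEquiv h).symm.toLinearMap ∘ₗ LinearMap.mul' K (QWP Q d) ∘ₗ
    TensorProduct.map (ofW Q d) (ofW Q d)

end PBW

/-! ### Twisted Hecke algebras -/

section Hecke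

variable {K : Type*} [CommRing K]

/-- The parameters of the twisted Hecke algebra: base algebra `K`, `σ = 1`, `ρ = 0`, and `S`, `R`
the scalars `χ(S)`, `χ(R)`. -/
def heckeParams (χS χR : K) : Params K K where
  S := χS • (1 ⊗ₜ 1)
  R := χR • (1 ⊗ₜ 1)
  σ := 1
  ρ := 0

/-- The twisted Hecke algebra, with generators `h_i` and relations
`h_i ^ 2 = χ(S) h_i + χ(R)` together with the braid relations. -/
abbrev Hecke (χS χR : K) (d : ℕ) : Type _ := QWP (heckeParams χS χR) d

/-- The generator `h_i` of the twisted Hecke algebra. -/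
def hGen (χS χR : K) {d : ℕ} (i : Fin (d - 1)) : Hecke χS χR d := H (heckeParams χS χR) i

end Hecke

/-! ### The structure map and ground modules -/

section Module

variable {K B : Type*} [CommRing K] [Ring B] [Algebra K B]
variable {M : Type*} [AddCommGroup M] [Module K M] [Module B M] [IsScalarTower K B M]

/-- The action of `B^{⊗ d}` on `M^{⊗ d}`, factor by factor. -/
def act (K B M : Type*) [CommRing K] [Ring B] [Algebra K B] [AddCommGroup M] [Module K M]
    [Module B M] [IsScalarTower K B M] (d : ℕ) :
    TPow K d B →ₗ[K] TPow K d M →ₗ[K] TPow K d M :=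
  PiTensorProduct.piTensorHomMap ∘ₗ
    PiTensorProduct.map (fun _ => (Algebra.lsmul K K M : B →ₐ[K] Module.End K M).toLinearMap)

/-- The structure map `α_M : B^{⊗ d} ⊗ M^{⊗ d} → M^{⊗ d}`. -/
def actT (K B M : Type*) [CommRing K] [Ring B] [Algebra K B] [AddCommGroup M] [Module K M]
    [Module B M] [IsScalarTower K B M] (d : ℕ) :
    TPow K d B ⊗[K] TPow K d M →ₗ[K] TPow K d M :=
  TensorProduct.lift (act K B M d)

/-- `τ^M (s_i ⊗ m) = σ^M_i (m) ⊗ h_i + ρ^M_i (m) ⊗ 1`. -/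
def tauSimple (σM ρM : Module.End K (M ⊗[K] M)) (χS χR : K) {d : ℕ} (i : Fin (d - 1)) :
    TPow K d M →ₗ[K] TPow K d M ⊗[K] Hecke χS χR d :=
  (TensorProduct.mk K (TPow K d M) (Hecke χS χR d)).flip (hGen χS χR i) ∘ₗ locEnd i σM +
    (TensorProduct.mk K (TPow K d M) (Hecke χS χR d)).flip 1 ∘ₗ locEnd i ρM

/-- Given `t : M^{⊗ d} → M^{⊗ d} ⊗ Hecke`, the map `(1 ⊗ μ) ∘ (t ⊗ 1)` on `M^{⊗ d} ⊗ Hecke`. -/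
def extendRight {χS χR : K} {d : ℕ} (t : TPow K d M →ₗ[K] TPow K d M ⊗[K] Hecke χS χR d) :
    TPow K d M ⊗[K] Hecke χS χR d →ₗ[K] TPow K d M ⊗[K] Hecke χS χR d :=
  LinearMap.lTensor (TPow K d M) (LinearMap.mul' K (Hecke χS χR d)) ∘ₗ
    (TensorProduct.assoc K (TPow K d M) (Hecke χS χR d) (Hecke χS χR d)).toLinearMap ∘ₗ
      LinearMap.rTensor (Hecke χS χR d) t

/-- The recursion along an expression: the empty expression gives `m ↦ m ⊗ 1`, and `s_i L` gives
`(1 ⊗ μ) ∘ (τ^M (s_i ⊗ ·) ⊗ 1)` after the map of `L`. -/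
def tauWord (σM ρM : Module.End K (M ⊗[K] M)) (χS χR : K) {d : ℕ} :
    List (Fin (d - 1)) → (TPow K d M →ₗ[K] TPow K d M ⊗[K] Hecke χS χR d)
  | [] => (TensorProduct.mk K (TPow K d M) (Hecke χS χR d)).flip 1
  | i :: L => extendRight (tauSimple σM ρM χS χR i) ∘ₗ tauWord σM ρM χS χR L

/-- The structure map `τ^M(r) : W ⊗ M^{⊗ d} → M^{⊗ d} ⊗ Hecke` of a choice `r`. -/
def tau (σM ρM : Module.End K (M ⊗[K] M)) (χS χR : K) {d : ℕ} (c : ChoiceMap d) :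
    W K d ⊗[K] TPow K d M →ₗ[K] TPow K d M ⊗[K] Hecke χS χR d :=
  TensorProduct.lift
    (Finsupp.linearCombination K fun w => tauWord σM ρM χS χR (c.r w))

/-- Commutativity of the first diagram: the two maps
`W ⊗ B^{⊗ d} ⊗ M^{⊗ d} → M^{⊗ d} ⊗ Hecke` given by `τ^M ∘ (1 ⊗ α_M)` and
`(α_M ⊗ 1) ∘ (1 ⊗ τ^M) ∘ (τ^B ⊗ 1)` agree. -/
def DiagramWB {Q : Params K B} {d : ℕ} (h : HasPBWBasis Q d) {χS χR : K}
    (t : W K d ⊗[K] TPow K d M →ₗ[K] TPow K d M ⊗[K] Hecke χS χR d) : Prop :=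
  t ∘ₗ LinearMap.lTensor (W K d) (actT K B M d) ∘ₗ
      (TensorProduct.assoc K (W K d) (TPow K d B) (TPow K d M)).toLinearMap =
    LinearMap.rTensor (Hecke χS χR d) (actT K B M d) ∘ₗ
      (TensorProduct.assoc K (TPow K d B) (TPow K d M) (Hecke χS χR d)).symm.toLinearMap ∘ₗ
      LinearMap.lTensor (TPow K d B) t ∘ₗ
      (TensorProduct.assoc K (TPow K d B) (W K d) (TPow K d M)).toLinearMap ∘ₗ
      LinearMap.rTensor (TPow K d M) (tauB h)

/-- Commutativity of the second diagram: the two maps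
`W ⊗ W ⊗ M^{⊗ d} → M^{⊗ d} ⊗ Hecke` given by `(1 ⊗ μ) ∘ (τ^M ⊗ 1) ∘ (1 ⊗ τ^M)` and
`(α_M ⊗ 1) ∘ (1 ⊗ τ^M) ∘ (m_W ⊗ 1)` agree. -/
def DiagramWW {Q : Params K B} {d : ℕ} (h : HasPBWBasis Q d) {χS χR : K}
    (t : W K d ⊗[K] TPow K d M →ₗ[K] TPow K d M ⊗[K] Hecke χS χR d) : Prop :=
  LinearMap.lTensor (TPow K d M) (LinearMap.mul' K (Hecke χS χR d)) ∘ₗ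
      (TensorProduct.assoc K (TPow K d M) (Hecke χS χR d) (Hecke χS χR d)).toLinearMap ∘ₗ
      LinearMap.rTensor (Hecke χS χR d) t ∘ₗ
      (TensorProduct.assoc K (W K d) (TPow K d M) (Hecke χS χR d)).symm.toLinearMap ∘ₗ
      LinearMap.lTensor (W K d) t ∘ₗ
      (TensorProduct.assoc K (W K d) (W K d) (TPow K d M)).toLinearMap =
    LinearMap.rTensor (Hecke χS χR d) (actT K B M d) ∘ₗ
      (TensorProduct.assoc K (TPow K d B) (TPow K d M) (Hecke χS χR d)).symm.toLinearMap ∘ₗ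
      LinearMap.lTensor (TPow K d B) t ∘ₗ
      (TensorProduct.assoc K (TPow K d B) (W K d) (TPow K d M)).toLinearMap ∘ₗ
      LinearMap.rTensor (TPow K d M) (mulW h)

/-- The tuple `(M, σ^M, ρ^M, S^M, R^M)`, where `S^M` and `R^M` are the scalars `χ(S)` and `χ(R)`,
is a ground module: `τ^M(r)` does not depend on `r`, and both diagrams commute. -/
structure IsGroundModule {Q : Params K B} {d : ℕ} (h : HasPBWBasis Q d)
    (σM ρM : Module.End K (M ⊗[K] M)) (χS χR : K) : Prop where
  indep : ∀ c c' : ChoiceMap d, tau σM ρM χS χR c = tau σM ρM χS χR c'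
  wb : ∀ c : ChoiceMap d, DiagramWB h (tau σM ρM χS χR c)
  ww : ∀ c : ChoiceMap d, DiagramWW h (tau σM ρM χS χR c)

/-! ### The explicit conditions -/

/-- Compatibility of `σ^M_i` and `ρ^M_i` with the wreath relations. -/
def CondM2 (Q : Params K B) (d : ℕ) (σM ρM : Module.End K (M ⊗[K] M)) : Prop :=
  ∀ (i : Fin (d - 1)) (b : TPow K d B) (m : TPow K d M),
    locEnd i σM (act K B M d b m) = act K B M d (locEnd i Q.σ b) (locEnd i σM m) ∧
    locEnd i ρM (act K B M d b m) =
      act K B M d (locEnd i Q.σ b) (locEnd i ρM m) + act K B M d (locEnd i Q.ρ b) m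

/-- Compatibility of `σ^M_i` and `ρ^M_i` with the quadratic relations; `act` of an element `X` is
the left multiplication `l^M_X`. -/
def CondM4 (Q : Params K B) (d : ℕ) (σM ρM : Module.End K (M ⊗[K] M)) (χS χR : K) : Prop :=
  ∀ i : Fin (d - 1),
    χS • (locEnd i σM * locEnd i σM) + locEnd i ρM * locEnd i σM + locEnd i σM * locEnd i ρM =
      (act K B M d (locElt i Q.S) : Module.End K (TPow K d M)) * locEnd i σM ∧
    χR • (locEnd i σM * locEnd i σM) + locEnd i ρM * locEnd i ρM =
      (act K B M d (locElt i Q.S) : Module.End K (TPow K d M)) * locEnd i ρM +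
        act K B M d (locElt i Q.R)

/-- `|i - j| = 1`. -/
def Adjacent {n : ℕ} (i j : Fin n) : Prop := (i : ℕ) + 1 = j ∨ (j : ℕ) + 1 = i

/-- The two braid-type conditions on `σ^M` and on `ρ^M`, `σ^M`. -/
def CondM5 (d : ℕ) (σM ρM : Module.End K (M ⊗[K] M)) : Prop :=
  ∀ i j : Fin (d - 1), Adjacent i j →
    (locEnd i σM * locEnd j σM * locEnd i σM : Module.End K (TPow K d M)) =
      locEnd j σM * locEnd i σM * locEnd j σM ∧
    (locEnd i ρM * locEnd j σM * locEnd i σM : Module.End K (TPow K d M)) =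
      locEnd j σM * locEnd i σM * locEnd j ρM

/-- The braid-type condition on `ρ^M_i σ^M_j ρ^M_i`. -/
def CondM6 (d : ℕ) (σM ρM : Module.End K (M ⊗[K] M)) (χS : K) : Prop :=
  ∀ i j : Fin (d - 1), Adjacent i j →
    (locEnd i ρM * locEnd j σM * locEnd i ρM : Module.End K (TPow K d M)) =
      χS • (locEnd j σM * locEnd i ρM * locEnd j σM) +
        locEnd j ρM * locEnd i ρM * locEnd j σM + locEnd j σM * locEnd i ρM * locEnd j ρM

/-- The braid-type condition on `ρ^M_i ρ^M_j ρ^M_i`. -/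
def CondM7 (d : ℕ) (σM ρM : Module.End K (M ⊗[K] M)) (χR : K) : Prop :=
  ∀ i j : Fin (d - 1), Adjacent i j →
    (locEnd i ρM * locEnd j ρM * locEnd i ρM : Module.End K (TPow K d M)) +
        χR • (locEnd i σM * locEnd j ρM * locEnd i σM) =
      locEnd j ρM * locEnd i ρM * locEnd j ρM +
        χR • (locEnd j σM * locEnd i ρM * locEnd j σM)

end Module

end QuantumWreath

end

/-! Let `X` be the tensor product of `M^{⊗ d}` with the twisted Hecke algebra, and let `T_i`
(`simpleOp`) be the operator `m ⊗ h ↦ σ_i(m) ⊗ h_i h + ρ_i(m) ⊗ h` on it. Each `T_i` commutes with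
right multiplication by Hecke elements, so identities between products of the `T_i` and the action
of `B^{⊗ d}` need only be checked on the vectors `m ⊗ 1`. The structure map along a word is the
product of the corresponding `T_i` applied to `m ⊗ 1`.

The explicit conditions are the relations of `B ≀ H(d)` for these operators, read off coefficient by
coefficient: (M2) is the wreath relation, (M4) the quadratic relation, (M5)-(M7) the braid relation.
Commutation of distant `T_i` is automatic.

Sufficiency: by the universal property, `B ≀ H(d)` acts on `X` (`wreathRep`). Products of the `T_i`
along reduced words depend only on the permutation (`BraidFamily.prod_eq`), so `τ^M(w ⊗ m) = H_w ·
(m ⊗ 1)` for every choice of expressions. Both diagrams then say that the action is multiplicative,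
after the PBW identification of `B^{⊗ d} ⊗ W` with the algebra (`actAfter_tau`).

Necessity: (WB) at `s_i` and (WW) at `(s_i, s_i)` give the wreath and quadratic relations on `m ⊗
1`. (WW) at `(s_i, w)` with `s_i w > w` gives `T_i τ^M(w ⊗ m) = τ^M(s_i w ⊗ m)`, so both sides of
the braid relation at `m ⊗ 1` equal `τ^M(s_i s_j s_i ⊗ m)`. The conditions follow by comparing
coefficients of the elements `h_w`. These coefficients are well defined because the Hecke algebra
acts on the free module on the symmetric group with `h_w` sending the basis vector of `1` to that of
`w` (`heckeRep`, `coeffAt_tmul`). -/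

noncomputable section

namespace QuantumWreath

/-! ### Descents, inversions and the word property of the symmetric group -/

section Symmetric

variable {d : ℕ}

/-- The simple transposition `s_i` is a left descent of `w`. -/
def Descent (i : Fin (d - 1)) (w : Equiv.Perm (Fin d)) : Prop := w⁻¹ (hi i) < w⁻¹ (lo i)

instance (i : Fin (d - 1)) (w : Equiv.Perm (Fin d)) : Decidable (Descent i w) :=
  inferInstanceAs (Decidable (_ < _))

@[simp] theorem simple_mul_self (i : Fin (d - 1)) : simple i * simple i = 1 :=
  Equiv.swap_mul_self _ _

@[simp] theorem simple_mul_cancel_left (i : Fin (d - 1)) (w : Equiv.Perm (Fin d)) :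
    simple i * (simple i * w) = w := by
  rw [← mul_assoc, simple_mul_self, one_mul]

@[simp] theorem simple_inv (i : Fin (d - 1)) : (simple i)⁻¹ = simple i := Equiv.swap_inv _ _

@[simp] theorem simple_lo (i : Fin (d - 1)) : simple i (lo i) = hi i := Equiv.swap_apply_left _ _

@[simp] theorem simple_hi (i : Fin (d - 1)) : simple i (hi i) = lo i := Equiv.swap_apply_right _ _

theorem inv_simple_mul_apply (i : Fin (d - 1)) (w : Equiv.Perm (Fin d)) (a : Fin d) :
    (simple i * w)⁻¹ a = w⁻¹ (simple i a) := by
  simp [mul_inv_rev]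

theorem descent_simple_mul_self (i : Fin (d - 1)) (w : Equiv.Perm (Fin d)) :
    Descent i (simple i * w) ↔ ¬ Descent i w := by
  simp only [Descent, inv_simple_mul_apply, simple_lo, simple_hi, not_lt]
  exact ⟨le_of_lt, fun h => lt_of_le_of_ne h fun e => lo_ne_hi i (w⁻¹.injective e)⟩

/-- No value lies strictly between the two exchanged ones, so only their own order can be reversed.
-/
theorem simple_lt_simple (i : Fin (d - 1)) {a b : Fin d} (h : a < b)
    (hne : ¬ (a = lo i ∧ b = hi i)) : simple i a < simple i b := by
  unfold simple
  simp only [Equiv.swap_apply_def, Fin.ext_iff, Fin.lt_def, lo, hi] at *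
  split_ifs <;> (try simp only) <;> omega

/-- The pairs of values of `w` which are inverted by `w⁻¹`. -/
def invSet (w : Equiv.Perm (Fin d)) : Finset (Fin d × Fin d) :=
  Finset.univ.filter fun p => p.1 < p.2 ∧ w⁻¹ p.2 < w⁻¹ p.1

theorem mem_invSet {w : Equiv.Perm (Fin d)} {p : Fin d × Fin d} :
    p ∈ invSet w ↔ p.1 < p.2 ∧ w⁻¹ p.2 < w⁻¹ p.1 := by
  simp [invSet]

/-- Relabelling values by `s_i` carries old inversions to new ones; the exchanged pair is the only
one whose order the relabelling reverses. -/
theorem invSet_simple_mul {i : Fin (d - 1)} {w : Equiv.Perm (Fin d)} (h : ¬ Descent i w) :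
    invSet (simple i * w) = insert (lo i, hi i)
      ((invSet w).map ((Equiv.prodCongr (simple i) (simple i)).toEmbedding)) := by
  have hlt : lo i < hi i := by simp [lo, hi, Fin.lt_def]
  ext ⟨a, b⟩
  simp only [Finset.mem_insert, Finset.mem_map_equiv, mem_invSet, inv_simple_mul_apply,
    Equiv.prodCongr_symm, Equiv.prodCongr_apply, Prod.map, Prod.mk.injEq]
  have hs : (simple i).symm = simple i := simple_inv i
  rw [hs]
  have hD : ¬ w⁻¹ (hi i) < w⁻¹ (lo i) := h
  constructor
  · rintro ⟨hab, hw⟩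
    by_cases hne : a = lo i ∧ b = hi i
    · exact Or.inl hne
    · exact Or.inr ⟨simple_lt_simple i hab hne, hw⟩
  · rintro (⟨rfl, rfl⟩ | ⟨hab, hw⟩)
    · refine ⟨hlt, ?_⟩
      rw [simple_lo, simple_hi]
      exact lt_of_le_of_ne (not_lt.1 hD) fun e => lo_ne_hi i (w⁻¹.injective e)
    · refine ⟨?_, hw⟩
      have := simple_lt_simple i hab (by
        rintro ⟨h1, h2⟩
        rw [h1, h2] at hw
        exact hD hw)
      simpa [simple] using this

theorem card_invSet_simple_mul {i : Fin (d - 1)} {w : Equiv.Perm (Fin d)} (h : ¬ Descent i w) :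
    (invSet (simple i * w)).card = (invSet w).card + 1 := by
  rw [invSet_simple_mul h, Finset.card_insert_of_notMem, Finset.card_map]
  have hlt : ¬ hi i < lo i := by simp [lo, hi, Fin.lt_def]
  have hs : (simple i).symm = simple i := simple_inv i
  simp [Finset.mem_map_equiv, mem_invSet, hs, hlt]

theorem card_invSet_of_descent {i : Fin (d - 1)} {w : Equiv.Perm (Fin d)} (h : Descent i w) :
    (invSet w).card = (invSet (simple i * w)).card + 1 := by
  have h' : ¬ Descent i (simple i * w) := by rwa [descent_simple_mul_self, not_not]
  simpa using card_invSet_simple_mul h'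

/-- Without descents `w⁻¹` increases at each consecutive step. A strictly monotone map with full
range is the identity. -/
theorem eq_one_of_forall_not_descent {w : Equiv.Perm (Fin d)}
    (h : ∀ i : Fin (d - 1), ¬ Descent i w) : w = 1 := by
  cases d with
  | zero => exact Subsingleton.elim _ _
  | succ n =>
    have hm : StrictMono (w⁻¹ : Equiv.Perm (Fin (n + 1))) := by
      rw [Fin.strictMono_iff_lt_succ]
      intro i
      have := not_lt.1 (h i)
      exact lt_of_le_of_ne this fun e => lo_ne_hi (d := n + 1) i (w⁻¹.injective e)
    rw [← inv_inj, inv_one]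
    exact Equiv.ext fun x => congrFun (hm.range_inj strictMono_id |>.1 (by simp)) x

theorem wordProd_cons (i : Fin (d - 1)) (L : List (Fin (d - 1))) :
    wordProd (i :: L) = simple i * wordProd L := by
  simp [wordProd]

theorem len_wordProd_le (L : List (Fin (d - 1))) : len (wordProd L) ≤ L.length :=
  Nat.sInf_le ⟨L, rfl, rfl⟩

theorem card_invSet_simple_mul_le (i : Fin (d - 1)) (w : Equiv.Perm (Fin d)) :
    (invSet (simple i * w)).card ≤ (invSet w).card + 1 := by
  by_cases h : Descent i w
  · have := card_invSet_of_descent h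
    omega
  · exact (card_invSet_simple_mul h).le

theorem card_invSet_wordProd_le (L : List (Fin (d - 1))) :
    (invSet (wordProd L)).card ≤ L.length := by
  induction L with
  | nil =>
    have : invSet (wordProd ([] : List (Fin (d - 1)))) = ∅ := by
      ext p
      simp only [mem_invSet, wordProd, List.map_nil, List.prod_nil, inv_one, Equiv.Perm.one_apply,
        Finset.notMem_empty, iff_false]
      exact fun h => lt_asymm h.1 h.2
    simp [this]
  | cons i L ih =>
    rw [wordProd_cons, List.length_cons]
    exact (card_invSet_simple_mul_le i _).trans (by omega)

/-- Removing a left descent lowers the number of inversions by exactly one, and a descent exists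
until the identity is reached. -/
theorem exists_word_length_eq (n : ℕ) (w : Equiv.Perm (Fin d)) (h : (invSet w).card = n) :
    ∃ L : List (Fin (d - 1)), wordProd L = w ∧ L.length = n := by
  induction n generalizing w with
  | zero =>
    refine ⟨[], ?_, rfl⟩
    refine (eq_one_of_forall_not_descent fun i hi => ?_).symm
    have := card_invSet_of_descent hi
    omega
  | succ n ih =>
    have : ∃ i : Fin (d - 1), Descent i w := by
      by_contra hcon
      push Not at hcon
      obtain rfl := eq_one_of_forall_not_descent hcon
      have := card_invSet_wordProd_le ([] : List (Fin (d - 1)))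
      simp only [wordProd, List.map_nil, List.prod_nil, List.length_nil] at this
      omega
    obtain ⟨i, hD⟩ := this
    have hc := card_invSet_of_descent hD
    obtain ⟨L, hL, hn⟩ := ih (simple i * w) (by omega)
    exact ⟨i :: L, by rw [wordProd_cons, hL, simple_mul_cancel_left], by simp [hn]⟩

theorem len_eq_card_invSet (w : Equiv.Perm (Fin d)) : len w = (invSet w).card := by
  apply le_antisymm
  · obtain ⟨L, rfl, hL⟩ := exists_word_length_eq _ w rfl
    exact hL ▸ len_wordProd_le L
  · obtain ⟨L, rfl, hL⟩ := exists_reducedExpr w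
    exact hL ▸ card_invSet_wordProd_le L

theorem len_of_descent {i : Fin (d - 1)} {w : Equiv.Perm (Fin d)} (h : Descent i w) :
    len w = len (simple i * w) + 1 := by
  simpa only [len_eq_card_invSet] using card_invSet_of_descent h

theorem len_of_not_descent {i : Fin (d - 1)} {w : Equiv.Perm (Fin d)} (h : ¬ Descent i w) :
    len (simple i * w) = len w + 1 := by
  simpa only [len_eq_card_invSet] using card_invSet_simple_mul h

theorem len_one : len (1 : Equiv.Perm (Fin d)) = 0 :=
  Nat.le_zero.1 (len_wordProd_le [])

theorem isReducedExpr_one : IsReducedExpr (1 : Equiv.Perm (Fin d)) [] :=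
  ⟨rfl, len_one.symm⟩

/-- This recursive form of reducedness drives every induction over reduced expressions below. -/
theorem isReducedExpr_cons {i : Fin (d - 1)} {w : Equiv.Perm (Fin d)} {L : List (Fin (d - 1))} :
    IsReducedExpr w (i :: L) ↔ Descent i w ∧ IsReducedExpr (simple i * w) L := by
  constructor
  · rintro ⟨h1, h2⟩
    have h3 : wordProd L = simple i * w := by rw [← h1, wordProd_cons, simple_mul_cancel_left]
    have h4 := len_wordProd_le L
    rw [h3] at h4
    simp only [List.length_cons] at h2
    have hD : Descent i w := by
      by_contra hD
      have := len_of_not_descent hD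
      omega
    have := len_of_descent hD
    exact ⟨hD, h3, by omega⟩
  · rintro ⟨hD, h1, h2⟩
    have := len_of_descent hD
    exact ⟨by rw [wordProd_cons, h1, simple_mul_cancel_left], by simp; omega⟩

/-! ### Adjacent generators: descents read off from the order of `w⁻¹` on three consecutive values.
-/

section Adjacent

variable {i j : Fin (d - 1)} (hij : (i : ℕ) + 1 = j)
include hij

theorem hi_eq_lo : hi i = lo j := by
  simp [hi, lo, hij]

theorem simple_apply_hi_succ : simple i (hi j) = hi j :=
  Equiv.swap_apply_of_ne_of_ne (by simp [lo, hi, Fin.ext_iff]; omega)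
    (by simp [hi, Fin.ext_iff]; omega)

theorem simple_succ_apply_lo : simple j (lo i) = lo i :=
  Equiv.swap_apply_of_ne_of_ne (by simp [lo, Fin.ext_iff]; omega)
    (by simp [lo, hi, Fin.ext_iff]; omega)

theorem simple_apply_lo_succ : simple i (lo j) = lo i := by
  rw [← hi_eq_lo hij, simple_hi]

theorem simple_succ_apply_hi : simple j (hi i) = hi j := by
  rw [hi_eq_lo hij, simple_lo]

theorem simple_braid : simple i * simple j * simple i = simple j * simple i * simple j := by
  unfold simple
  rw [hi_eq_lo hij]
  have h1 : lo i ≠ lo j := hi_eq_lo hij ▸ lo_ne_hi i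
  have h2 : lo j ≠ hi j := lo_ne_hi j
  have h3 : lo i ≠ hi j := by simp [lo, hi, Fin.ext_iff]; omega
  have e := Equiv.swap_mul_swap_mul_swap h2.symm h3.symm
  rw [Equiv.swap_comm (lo j) (lo i), Equiv.swap_comm (hi j) (lo j)] at e
  rw [e, Equiv.swap_mul_swap_mul_swap h1 h3, Equiv.swap_comm]

theorem simple_braid_mul (w : Equiv.Perm (Fin d)) :
    simple i * (simple j * (simple i * w)) = simple j * (simple i * (simple j * w)) := by
  simpa only [mul_assoc] using congrArg (· * w) (simple_braid hij)

theorem descent_succ_simple_mul (w : Equiv.Perm (Fin d)) :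
    Descent j (simple i * w) ↔ w⁻¹ (hi j) < w⁻¹ (lo i) := by
  rw [Descent, inv_simple_mul_apply, inv_simple_mul_apply, simple_apply_hi_succ hij,
    simple_apply_lo_succ hij]

theorem descent_simple_succ_mul (w : Equiv.Perm (Fin d)) :
    Descent i (simple j * w) ↔ w⁻¹ (hi j) < w⁻¹ (lo i) := by
  rw [Descent, inv_simple_mul_apply, inv_simple_mul_apply, simple_succ_apply_hi hij,
    simple_succ_apply_lo hij]

theorem descent_simple_succ_mul_simple_mul (w : Equiv.Perm (Fin d)) :
    Descent i (simple j * (simple i * w)) ↔ Descent j w := by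
  rw [descent_simple_succ_mul hij, inv_simple_mul_apply, inv_simple_mul_apply,
    simple_apply_hi_succ hij, simple_lo, hi_eq_lo hij, Descent]

theorem descent_succ_simple_mul_simple_succ_mul (w : Equiv.Perm (Fin d)) :
    Descent j (simple i * (simple j * w)) ↔ Descent i w := by
  rw [descent_succ_simple_mul hij, inv_simple_mul_apply, inv_simple_mul_apply,
    simple_succ_apply_lo hij, simple_hi, ← hi_eq_lo hij, Descent]

theorem lt_of_descent_of_descent {w : Equiv.Perm (Fin d)} (h : Descent i w) (h' : Descent j w) :
    w⁻¹ (hi j) < w⁻¹ (lo i) := by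
  rw [Descent, ← hi_eq_lo hij] at h'
  exact h'.trans h

theorem not_lt_of_not_descent {w : Equiv.Perm (Fin d)} (h : ¬ Descent i w)
    (h' : ¬ Descent j w) : ¬ w⁻¹ (hi j) < w⁻¹ (lo i) := by
  rw [Descent, ← hi_eq_lo hij] at h'
  exact not_lt.2 ((not_lt.1 h).trans (not_lt.1 h'))

end Adjacent

/-! ### Distant generators commute and do not affect each other's descents. -/

section Distant

variable {i j : Fin (d - 1)} (hij : (i : ℕ) + 2 ≤ j ∨ (j : ℕ) + 2 ≤ i)
include hij

theorem simple_comm : simple i * simple j = simple j * simple i := by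
  apply Equiv.Perm.Disjoint.commute
  intro x
  by_cases h1 : x = lo i ∨ x = hi i
  · right
    refine Equiv.swap_apply_of_ne_of_ne ?_ ?_ <;> rcases h1 with rfl | rfl <;>
      simp [lo, hi, Fin.ext_iff] <;> omega
  · push Not at h1
    exact Or.inl (Equiv.swap_apply_of_ne_of_ne h1.1 h1.2)

theorem simple_comm_mul (w : Equiv.Perm (Fin d)) :
    simple i * (simple j * w) = simple j * (simple i * w) := by
  simpa only [mul_assoc] using congrArg (· * w) (simple_comm hij)

theorem descent_simple_mul_of_distant (w : Equiv.Perm (Fin d)) :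
    Descent i (simple j * w) ↔ Descent i w := by
  rw [Descent, inv_simple_mul_apply, inv_simple_mul_apply, simple,
    Equiv.swap_apply_of_ne_of_ne, Equiv.swap_apply_of_ne_of_ne, Descent] <;>
    simp [lo, hi, Fin.ext_iff] <;> omega

end Distant

/-- A family indexed by the simple transpositions which satisfies the braid relations. -/
structure BraidFamily {N : Type*} [Monoid N] (f : Fin (d - 1) → N) : Prop where
  braid : ∀ i j : Fin (d - 1), (i : ℕ) + 1 = j → f i * f j * f i = f j * f i * f j
  comm : ∀ i j : Fin (d - 1), ((i : ℕ) + 2 ≤ j ∨ (j : ℕ) + 2 ≤ i) → f i * f j = f j * f i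

/-- The product of a family of elements along a fixed reduced expression of `w`. -/
def redProd {N : Type*} [Monoid N] (f : Fin (d - 1) → N) (w : Equiv.Perm (Fin d)) : N :=
  ((reducedExpr w).map f).prod

/-- Matsumoto's theorem, by induction on length. The first letters `i`, `j` of the two words are
both descents of `w`, so `w` also has reduced words starting with the two sides of the braid or
commutation relation for `i`, `j` and continuing identically. The induction hypothesis compares
tails, and the relation compares the beginnings. -/
theorem BraidFamily.prod_eq {N : Type*} [Monoid N] {f : Fin (d - 1) → N} (hf : BraidFamily f)
    {w : Equiv.Perm (Fin d)} {L L' : List (Fin (d - 1))} (hL : IsReducedExpr w L)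
    (hL' : IsReducedExpr w L') : (L.map f).prod = (L'.map f).prod := by
  induction hn : len w using Nat.strong_induction_on generalizing w L L' with
  | _ n ih =>
  subst hn
  cases L with
  | nil =>
    have h0 : L'.length = 0 := by rw [hL'.2, ← hL.2]; rfl
    rw [List.length_eq_zero_iff.1 h0]
  | cons i T =>
    cases L' with
    | nil => exact absurd (hL.2.trans hL'.2.symm) (by simp)
    | cons j T' =>
      obtain ⟨hi, hT⟩ := isReducedExpr_cons.1 hL
      obtain ⟨hj, hT'⟩ := isReducedExpr_cons.1 hL'
      -- By induction, a reduced word of a shorter element can be traded for one starting with any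
      -- prescribed descent.
      have step : ∀ {x : Equiv.Perm (Fin d)} {k : Fin (d - 1)} {U : List (Fin (d - 1))},
          len x < len w → Descent k x → IsReducedExpr x U →
            (U.map f).prod = f k * redProd f (simple k * x) := by
        intro x k U hx hk hU
        have h1 : IsReducedExpr x (k :: reducedExpr (simple k * x)) :=
          isReducedExpr_cons.2 ⟨hk, Classical.choose_spec (exists_reducedExpr _)⟩
        rw [ih _ hx hU h1 rfl, List.map_cons, List.prod_cons, redProd]
      have step' : ∀ {x : Equiv.Perm (Fin d)} {k : Fin (d - 1)}, len x < len w → Descent k x →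
          redProd f x = f k * redProd f (simple k * x) := fun hx hk =>
        step hx hk (Classical.choose_spec (exists_reducedExpr _))
      have li := len_of_descent hi
      have lj := len_of_descent hj
      rw [List.map_cons, List.prod_cons, List.map_cons, List.prod_cons]
      -- Stated for fresh `i`, `j` so that it serves both orders of two adjacent letters.
      have adj : ∀ {i j : Fin (d - 1)} {T T' : List (Fin (d - 1))}, (i : ℕ) + 1 = j →
          Descent i w → Descent j w → IsReducedExpr (simple i * w) T →
          IsReducedExpr (simple j * w) T' → len w = len (simple i * w) + 1 →
          len w = len (simple j * w) + 1 → f i * (T.map f).prod = f j * (T'.map f).prod := by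
        intro i j T T' hij hi hj hT hT' li lj
        have hlt := lt_of_descent_of_descent hij hi hj
        have h1 := (descent_succ_simple_mul hij w).2 hlt
        have h2 := (descent_simple_succ_mul hij w).2 hlt
        have h3 := (descent_simple_succ_mul_simple_mul hij w).2 hj
        have h4 := (descent_succ_simple_mul_simple_succ_mul hij w).2 hi
        have l1 := len_of_descent h1
        have l2 := len_of_descent h2
        rw [step (by omega) h1 hT, step (by omega) h2 hT', step' (by omega) h3,
          step' (by omega) h4, simple_braid_mul hij]
        have hb := congrArg (· * redProd f (simple j * (simple i * (simple j * w))))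
            (hf.braid i j hij)
        simpa only [mul_assoc] using hb
      rcases lt_trichotomy (i : ℕ) j with hlt | heq | hlt
      · by_cases hij : (i : ℕ) + 1 = j
        · exact adj hij hi hj hT hT' li lj
        · have hd : (i : ℕ) + 2 ≤ j ∨ (j : ℕ) + 2 ≤ i := by omega
          have h1 := (descent_simple_mul_of_distant hd.symm w).2 hj
          have h2 := (descent_simple_mul_of_distant hd w).2 hi
          rw [step (by omega) h1 hT, step (by omega) h2 hT', simple_comm_mul hd,
            ← mul_assoc, ← mul_assoc, hf.comm i j hd, mul_assoc]
      · obtain rfl : i = j := Fin.ext heq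
        rw [ih _ (by omega) hT hT' rfl]
      · by_cases hij : (j : ℕ) + 1 = i
        · exact (adj hij hj hi hT' hT lj li).symm
        · have hd : (i : ℕ) + 2 ≤ j ∨ (j : ℕ) + 2 ≤ i := by omega
          have h1 := (descent_simple_mul_of_distant hd.symm w).2 hj
          have h2 := (descent_simple_mul_of_distant hd w).2 hi
          rw [step (by omega) h1 hT, step (by omega) h2 hT', simple_comm_mul hd,
            ← mul_assoc, ← mul_assoc, hf.comm i j hd, mul_assoc]

theorem BraidFamily.prod_eq_redProd {N : Type*} [Monoid N] {f : Fin (d - 1) → N}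
    (hf : BraidFamily f) {w : Equiv.Perm (Fin d)} {L : List (Fin (d - 1))}
    (hL : IsReducedExpr w L) : (L.map f).prod = redProd f w :=
  hf.prod_eq hL (Classical.choose_spec (exists_reducedExpr w))

theorem BraidFamily.mul_redProd {N : Type*} [Monoid N] {f : Fin (d - 1) → N}
    (hf : BraidFamily f) {i : Fin (d - 1)} {w : Equiv.Perm (Fin d)} (h : ¬ Descent i w) :
    f i * redProd f w = redProd f (simple i * w) := by
  have hr : IsReducedExpr (simple i * w) (i :: reducedExpr w) := by
    rw [isReducedExpr_cons, descent_simple_mul_self, simple_mul_cancel_left]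
    exact ⟨h, Classical.choose_spec (exists_reducedExpr w)⟩
  rw [← hf.prod_eq_redProd hr, List.map_cons, List.prod_cons, redProd]

theorem BraidFamily.redProd_one {N : Type*} [Monoid N] {f : Fin (d - 1) → N}
    (hf : BraidFamily f) : redProd f 1 = 1 :=
  (hf.prod_eq_redProd isReducedExpr_one).symm

theorem not_descent_one (i : Fin (d - 1)) : ¬ Descent i (1 : Equiv.Perm (Fin d)) := by
  simp [Descent, lo, hi, Fin.lt_def]

theorem BraidFamily.redProd_simple {N : Type*} [Monoid N] {f : Fin (d - 1) → N}
    (hf : BraidFamily f) (i : Fin (d - 1)) : redProd f (simple i) = f i := by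
  have := hf.mul_redProd (not_descent_one i)
  rwa [hf.redProd_one, mul_one, mul_one, eq_comm] at this

/-- A left factor `s_i` changes the length by exactly one, so the strict decrease required of a
choice forces a descent at each step. -/
theorem ChoiceMap.isReducedExpr (c : ChoiceMap d) (w : Equiv.Perm (Fin d)) :
    IsReducedExpr w (c.r w) := by
  induction hn : len w using Nat.strong_induction_on generalizing w with
  | _ n ih =>
  subst hn
  by_cases h1 : w = 1
  · rw [h1, c.r_one]
    exact isReducedExpr_one
  · obtain ⟨i, x, hx, hlt, hr⟩ := c.r_step w h1
    have hx' : simple i * w = x := by rw [hx, simple_mul_cancel_left]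
    rw [hr, isReducedExpr_cons, hx']
    refine ⟨?_, ih _ hlt x rfl⟩
    by_contra hD
    have := len_of_not_descent hD
    rw [hx'] at this
    omega

open scoped Classical in
/-- The first `n` letters of an expression of `w` obtained by removing descents. -/
def greedyWord : ℕ → Equiv.Perm (Fin d) → List (Fin (d - 1))
  | 0, _ => []
  | n + 1, w =>
    if h : ∃ i : Fin (d - 1), Descent i w then
      h.choose :: greedyWord n (simple h.choose * w)
    else []

/-- Ground modules quantify over all choices; necessity needs one choice at which to evaluate the
diagrams. -/
theorem nonempty_choiceMap : Nonempty (ChoiceMap d) := by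
  -- The fuel `len w` drops by one with each removed descent, so the tail is the word chosen for the
  -- shorter element.
  refine ⟨⟨fun w => greedyWord (len w) w, by rw [len_one, greedyWord], fun w hw => ?_⟩⟩
  have h : ∃ i : Fin (d - 1), Descent i w := by
    by_contra hcon
    push Not at hcon
    exact hw (eq_one_of_forall_not_descent hcon)
  have hl := len_of_descent h.choose_spec
  refine ⟨h.choose, simple h.choose * w, (simple_mul_cancel_left _ _).symm, by omega, ?_⟩
  conv_lhs => rw [hl, greedyWord, dif_pos h]

end Symmetric

/-! ### Local operators and the factorwise action -/

section Local

variable {d : ℕ} {K : Type*} [CommRing K] {V : Type*} [AddCommGroup V] [Module K V]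

theorem lo_hi_ne_of_distant {i j : Fin (d - 1)} (hij : (i : ℕ) + 2 ≤ j ∨ (j : ℕ) + 2 ≤ i) :
    lo i ≠ lo j ∧ lo i ≠ hi j ∧ hi i ≠ lo j ∧ hi i ≠ hi j := by
  simp only [lo, hi, ne_eq, Fin.ext_iff]
  omega

/-- Insertion of two tensors into two disjoint pairs of adjacent positions. -/
def pairPairAt (i j : Fin (d - 1)) (hij : (i : ℕ) + 2 ≤ j ∨ (j : ℕ) + 2 ≤ i) (v : Fin d → V) :
    V ⊗[K] V →ₗ[K] V ⊗[K] V →ₗ[K] TPow K d V :=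
  have h := lo_hi_ne_of_distant hij
  TensorProduct.lift
    (LinearMap.mk₂ K
      (fun a b => pairAt j (Function.update (Function.update v (lo i) a) (hi i) b))
      (by
        intro a a' b
        simp only [Function.update_comm (lo_ne_hi i)]
        exact pairAt_update_add _ _ _ h.1 h.2.1 _ _)
      (by
        intro c a b
        simp only [Function.update_comm (lo_ne_hi i)]
        exact pairAt_update_smul _ _ _ h.1 h.2.1 _ _)
      (fun a b b' => pairAt_update_add _ _ _ h.2.2.1 h.2.2.2 _ _)
      (fun c a b => pairAt_update_smul _ _ _ h.2.2.1 h.2.2.2 _ _))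

theorem pairPairAt_tmul (i j : Fin (d - 1)) (hij : (i : ℕ) + 2 ≤ j ∨ (j : ℕ) + 2 ≤ i)
    (v : Fin d → V) (a b : V) (z : V ⊗[K] V) :
    pairPairAt i j hij v (a ⊗ₜ b) z =
      pairAt j (Function.update (Function.update v (lo i) a) (hi i) b) z := by
  simp [pairPairAt]

theorem pairPairAt_symm (i j : Fin (d - 1)) (hij : (i : ℕ) + 2 ≤ j ∨ (j : ℕ) + 2 ≤ i)
    (v : Fin d → V) (z z' : V ⊗[K] V) :
    pairPairAt i j hij v z z' = pairPairAt j i hij.symm v z' z := by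
  obtain ⟨h1, h2, h3, h4⟩ := lo_hi_ne_of_distant hij
  have : pairPairAt (K := K) i j hij v = (pairPairAt j i hij.symm v).flip := by
    apply TensorProduct.ext'
    intro a b
    apply TensorProduct.ext'
    intro a' b'
    simp only [LinearMap.flip_apply, pairPairAt_tmul, pairAt_tmul]
    rw [Function.update_comm h3, Function.update_comm h1, Function.update_comm h4,
      Function.update_comm h2]
  rw [this, LinearMap.flip_apply]

theorem locEnd_pairAt (i j : Fin (d - 1)) (hij : (i : ℕ) + 2 ≤ j ∨ (j : ℕ) + 2 ≤ i)
    (v : Fin d → V) (ψ : Module.End K (V ⊗[K] V)) (z : V ⊗[K] V) :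
    locEnd j ψ (pairAt i v z) = pairPairAt i j hij v z (ψ (v (lo j) ⊗ₜ v (hi j))) := by
  obtain ⟨h1, h2, h3, h4⟩ := lo_hi_ne_of_distant hij
  induction z with
  | zero => simp
  | add x y hx hy => simp [hx, hy]
  | tmul a b =>
    rw [pairAt_tmul, locEnd_tprod, pairPairAt_tmul]
    simp [Function.update_of_ne, h1.symm, h2.symm, h3.symm, h4.symm]

/-- On a pure tensor both orders insert the same two images into disjoint pairs of positions. This
is why distant indices contribute no condition. -/
theorem locEnd_comm (i j : Fin (d - 1)) (hij : (i : ℕ) + 2 ≤ j ∨ (j : ℕ) + 2 ≤ i)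
    (φ ψ : Module.End K (V ⊗[K] V)) : locEnd i φ * locEnd j ψ = locEnd j ψ * locEnd i φ := by
  apply PiTensorProduct.ext
  ext v
  simp only [LinearMap.compMultilinearMap_apply, Module.End.mul_apply]
  rw [locEnd_tprod, locEnd_tprod, locEnd_pairAt i j hij, locEnd_pairAt j i hij.symm,
    pairPairAt_symm]

theorem pairAt_self (i : Fin (d - 1)) (v : Fin d → V) :
    pairAt (K := K) i v (v (lo i) ⊗ₜ v (hi i)) = PiTensorProduct.tprod K v := by
  rw [pairAt_tmul, Function.update_eq_self, Function.update_eq_self]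

theorem locEnd_one (i : Fin (d - 1)) : locEnd i (1 : Module.End K (V ⊗[K] V)) = 1 := by
  apply PiTensorProduct.ext
  ext v
  simp [locEnd_tprod, pairAt_self]

theorem locEnd_zero (i : Fin (d - 1)) : locEnd i (0 : Module.End K (V ⊗[K] V)) = 0 := by
  apply PiTensorProduct.ext
  ext v
  simp [locEnd_tprod]

theorem locElt_smul_one {B : Type*} [Ring B] [Algebra K B] (i : Fin (d - 1)) (c : K) :
    locElt i (c • ((1 : B) ⊗ₜ[K] (1 : B))) = algebraMap K (TPow K d B) c := by
  rw [locElt, map_smul, Algebra.algebraMap_eq_smul_one, PiTensorProduct.one_def]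
  exact congrArg (c • ·) (pairAt_self i _)

end Local

/-! ### Multiplicativity of the factorwise action. -/

section Act

variable {K B M : Type*} [CommRing K] [Ring B] [Algebra K B]
  [AddCommGroup M] [Module K M] [Module B M] [IsScalarTower K B M] {d : ℕ}

theorem act_tprod_tprod (b : Fin d → B) (m : Fin d → M) :
    act K B M d (PiTensorProduct.tprod K b) (PiTensorProduct.tprod K m) =
      PiTensorProduct.tprod K fun k => b k • m k := by
  simp [act]

theorem act_one : act K B M d 1 = LinearMap.id := by
  apply PiTensorProduct.ext
  ext m
  simp [PiTensorProduct.one_def, act_tprod_tprod]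

theorem act_mul (a b : TPow K d B) : act K B M d (a * b) = act K B M d a ∘ₗ act K B M d b := by
  induction a using PiTensorProduct.induction_on with
  | add x y hx hy => rw [add_mul, map_add, map_add, hx, hy, LinearMap.add_comp]
  | smul_tprod r f =>
    induction b using PiTensorProduct.induction_on with
    | add x y hx hy => rw [mul_add, map_add, map_add, hx, hy, LinearMap.comp_add]
    | smul_tprod s g =>
      apply PiTensorProduct.ext
      ext m
      simp only [smul_mul_assoc, mul_smul_comm, map_smul, LinearMap.compMultilinearMap_apply,
        LinearMap.smul_apply, LinearMap.comp_apply, PiTensorProduct.tprod_mul_tprod,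
        act_tprod_tprod, Pi.mul_apply, mul_smul]

end Act

/-! ### Universal property of quantum wreath products -/

section Universal

variable {K B : Type*} [CommRing K] [Ring B] [Algebra K B] {d : ℕ} (Q : Params K B)

variable {Q} in
theorem quot_eq_of_rel {x y : Pre K B d} (h : Rel Q d x y) : quot Q d x = quot Q d y :=
  RingQuot.mkAlgHom_rel K h

theorem braidFamily_H : BraidFamily (H Q : Fin (d - 1) → QWP Q d) where
  braid i j h := by
    have e := quot_eq_of_rel (Q := Q) (Rel.braid i j h)
    simp only [map_mul] at e
    exact e
  comm i j h := by
    have e := quot_eq_of_rel (Q := Q) (Rel.comm i j h)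
    simp only [map_mul] at e
    exact e

theorem H_mul_self (i : Fin (d - 1)) :
    H Q i * H Q i = ofBase Q d (locElt i Q.S) * H Q i + ofBase Q d (locElt i Q.R) := by
  have e := quot_eq_of_rel (Q := Q) (Rel.quad i)
  simp only [map_mul, map_add] at e
  exact e

theorem H_mul_ofBase (i : Fin (d - 1)) (b : TPow K d B) :
    H Q i * ofBase Q d b =
      ofBase Q d (locEnd i Q.σ b) * H Q i + ofBase Q d (locEnd i Q.ρ b) := by
  have e := quot_eq_of_rel (Q := Q) (Rel.wreath i b)
  simp only [map_mul, map_add] at e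
  exact e

theorem HW_one : HW Q (1 : Equiv.Perm (Fin d)) = 1 := (braidFamily_H Q).redProd_one

theorem HW_simple (i : Fin (d - 1)) : HW Q (simple i) = H Q i := (braidFamily_H Q).redProd_simple i

theorem H_mul_HW {i : Fin (d - 1)} {w : Equiv.Perm (Fin d)} (h : ¬ Descent i w) :
    H Q i * HW Q w = HW Q (simple i * w) := (braidFamily_H Q).mul_redProd h

variable {A : Type*} [Ring A] [Algebra K A]

/-- The algebra map out of `B ≀ H(d)` given by an algebra map on `B^{⊗ d}` and images of the
`H_i` satisfying the defining relations. -/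
def liftHom (f : TPow K d B →ₐ[K] A) (g : Fin (d - 1) → A) (hg : BraidFamily g)
    (hq : ∀ i, g i * g i = f (locElt i Q.S) * g i + f (locElt i Q.R))
    (hw : ∀ i b, g i * f b = f (locEnd i Q.σ b) * g i + f (locEnd i Q.ρ b)) :
    QWP Q d →ₐ[K] A :=
  RingQuot.liftAlgHom K ⟨FreeAlgebra.lift K (Sum.elim f g), by
    intro x y h
    cases h with
    | add a b => simp [preB]
    | mul a b => simp [preB]
    | scalar c => simp [preB]
    | braid i j h => simpa [preH] using hg.braid i j h
    | comm i j h => simpa [preH] using hg.comm i j h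
    | quad i => simpa [preH, preB] using hq i
    | wreath i b => simpa [preH, preB] using hw i b⟩

variable {Q} (f : TPow K d B →ₐ[K] A) (g : Fin (d - 1) → A) (hg : BraidFamily g)
    (hq : ∀ i, g i * g i = f (locElt i Q.S) * g i + f (locElt i Q.R))
    (hw : ∀ i b, g i * f b = f (locEnd i Q.σ b) * g i + f (locEnd i Q.ρ b))

theorem liftHom_quot (x : Pre K B d) :
    liftHom Q f g hg hq hw (quot Q d x) = FreeAlgebra.lift K (Sum.elim f g) x :=
  RingQuot.liftAlgHom_mkAlgHom_apply _ _ _ _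

theorem liftHom_ofBase (b : TPow K d B) : liftHom Q f g hg hq hw (ofBase Q d b) = f b :=
  (liftHom_quot f g hg hq hw (preB b)).trans (by simp [preB])

theorem liftHom_H (i : Fin (d - 1)) : liftHom Q f g hg hq hw (H Q i) = g i :=
  (liftHom_quot f g hg hq hw (preH i)).trans (by simp [preH])

end Universal

/-! ### Linear independence in twisted Hecke algebras -/

section Hecke

variable {K : Type*} [CommRing K] (χS χR : K) {d : ℕ}

theorem locElt_heckeParams_S (i : Fin (d - 1)) :
    locElt i (heckeParams χS χR).S = algebraMap K (TPow K d K) χS := locElt_smul_one _ _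

theorem locElt_heckeParams_R (i : Fin (d - 1)) :
    locElt i (heckeParams χS χR).R = algebraMap K (TPow K d K) χR := locElt_smul_one _ _

theorem hGen_mul_self (i : Fin (d - 1)) :
    hGen χS χR i * hGen χS χR i = χS • hGen χS χR i + χR • (1 : Hecke χS χR d) := by
  have := H_mul_self (heckeParams χS χR) i
  rwa [locElt_heckeParams_S, locElt_heckeParams_R, AlgHom.commutes, AlgHom.commutes,
    Algebra.algebraMap_eq_smul_one, Algebra.algebraMap_eq_smul_one, smul_mul_assoc,
    one_mul] at this

/-- Left multiplication by `h_i` on the standard basis. -/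
def heckeOp (i : Fin (d - 1)) : Module.End K (W K d) :=
  Finsupp.linearCombination K fun w =>
    if Descent i w then χS • Finsupp.single w 1 + χR • Finsupp.single (simple i * w) 1
    else Finsupp.single (simple i * w) 1

variable {χS χR} in
theorem heckeOp_of_descent {i : Fin (d - 1)} {w : Equiv.Perm (Fin d)} (h : Descent i w) :
    heckeOp χS χR i (Finsupp.single w 1) =
      χS • Finsupp.single w 1 + χR • Finsupp.single (simple i * w) 1 := by
  simp [heckeOp, h]

variable {χS χR} in
theorem heckeOp_of_not_descent {i : Fin (d - 1)} {w : Equiv.Perm (Fin d)} (h : ¬ Descent i w) :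
    heckeOp χS χR i (Finsupp.single w 1) = Finsupp.single (simple i * w) 1 := by
  simp [heckeOp, h]

theorem heckeOp_mul_self (i : Fin (d - 1)) :
    heckeOp χS χR i * heckeOp χS χR i = χS • heckeOp χS χR i + χR • 1 := by
  apply Finsupp.lhom_ext'
  intro w
  ext1
  simp only [LinearMap.comp_apply, Finsupp.lsingle_apply, Module.End.mul_apply,
    LinearMap.add_apply, LinearMap.smul_apply, Module.End.one_apply]
  have h' := descent_simple_mul_self i w
  by_cases h : Descent i w
  · rw [heckeOp_of_descent h, map_add, map_smul, map_smul, heckeOp_of_descent h,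
      heckeOp_of_not_descent (by rw [h']; exact not_not.2 h), simple_mul_cancel_left]
  · rw [heckeOp_of_not_descent h, heckeOp_of_descent (h'.2 h), simple_mul_cancel_left]

theorem braidFamily_heckeOp :
    BraidFamily (heckeOp χS χR : Fin (d - 1) → Module.End K (W K d)) where
  braid i j hij := by
    apply Finsupp.lhom_ext'
    intro w
    ext1
    simp only [LinearMap.comp_apply, Finsupp.lsingle_apply, Module.End.mul_apply]
    have e1 := descent_succ_simple_mul hij w
    have e2 := descent_simple_succ_mul hij w
    have e3 := descent_simple_succ_mul_simple_mul hij w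
    have e4 := descent_succ_simple_mul_simple_succ_mul hij w
    have e5 := descent_simple_mul_self i w
    have e6 := descent_simple_mul_self j w
    have c1 := lt_of_descent_of_descent hij (w := w)
    have c2 := not_lt_of_not_descent hij (w := w)
    have hb := simple_braid_mul hij w
    -- The three comparisons of `w⁻¹` on the three consecutive values decide every descent that
    -- occurs. Transitivity (`c1`, `c2`) rules out two of the eight cases.
    by_cases hi : Descent i w <;> by_cases hj : Descent j w <;>
      by_cases he : w⁻¹ (QuantumWreath.hi j) < w⁻¹ (lo i) <;>
      simp only [hi, hj, he, iff_true, iff_false, not_true_eq_false, not_false_eq_true,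
        forall_const, imp_false] at e1 e2 e3 e4 e5 e6 c1 c2 <;>
      simp only [heckeOp_of_descent, heckeOp_of_not_descent, hi, hj, e1, e2, e3, e4, e5, e6,
        not_false_eq_true, map_add, map_smul, hb,
        simple_mul_cancel_left] <;> module
  comm i j hij := by
    apply Finsupp.lhom_ext'
    intro w
    ext1
    simp only [LinearMap.comp_apply, Finsupp.lsingle_apply, Module.End.mul_apply]
    have e1 := descent_simple_mul_of_distant hij w
    have e2 := descent_simple_mul_of_distant hij.symm w
    have hb := simple_comm_mul hij w
    by_cases hi : Descent i w <;> by_cases hj : Descent j w <;>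
      simp only [hi, hj, iff_true, iff_false] at e1 e2 <;>
      simp only [heckeOp_of_descent, heckeOp_of_not_descent, hi, hj, e1, e2,
        not_false_eq_true, map_add, map_smul, hb] <;> module

/-- The representation of the twisted Hecke algebra on the free module on the symmetric group. -/
def heckeRep : Hecke χS χR d →ₐ[K] Module.End K (W K d) :=
  liftHom (heckeParams χS χR)
    -- The base algebra `K^{⊗ d}` is `K` itself and acts by scalars, so with `σ = 1` and `ρ = 0` the
    -- wreath relation says that scalars are central.
    ((Algebra.ofId K (Module.End K (W K d))).comp
      (PiTensorProduct.constantBaseRingEquiv (Fin d) K).toAlgHom)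
    (heckeOp χS χR) (braidFamily_heckeOp χS χR)
    (by
      intro i
      rw [locElt_heckeParams_S, locElt_heckeParams_R, AlgHom.commutes, AlgHom.commutes,
        heckeOp_mul_self, Algebra.algebraMap_eq_smul_one, Algebra.algebraMap_eq_smul_one,
        smul_mul_assoc, one_mul])
    (by
      intro i b
      simp only [heckeParams, locEnd_one, locEnd_zero, Module.End.one_apply, LinearMap.zero_apply,
        map_zero, add_zero]
      exact (Algebra.commutes (PiTensorProduct.constantBaseRingEquiv (Fin d) K b)
        (heckeOp χS χR i)).symm)

theorem heckeRep_hGen (i : Fin (d - 1)) : heckeRep χS χR (hGen χS χR i) = heckeOp χS χR i :=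
  liftHom_H ..

/-- The expansion of an element of the twisted Hecke algebra in the elements `h_w`. -/
def heckeRepr : Hecke χS χR d →ₗ[K] W K d :=
  LinearMap.applyₗ (Finsupp.single 1 1) ∘ₗ (heckeRep χS χR).toLinearMap

theorem heckeRepr_one : heckeRepr χS χR (1 : Hecke χS χR d) = Finsupp.single 1 1 := by
  simp [heckeRepr]

variable {χS χR} in
-- Expands reduced words letter by letter: a length-increasing factor only moves the basis vector.
theorem heckeRepr_hGen_mul {i : Fin (d - 1)} {w : Equiv.Perm (Fin d)} {x : Hecke χS χR d}
    (hx : heckeRepr χS χR x = Finsupp.single w 1) (h : ¬ Descent i w) :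
    heckeRepr χS χR (hGen χS χR i * x) = Finsupp.single (simple i * w) 1 := by
  simp only [heckeRepr, LinearMap.comp_apply, LinearMap.applyₗ_apply_apply,
    AlgHom.toLinearMap_apply] at hx
  simp only [heckeRepr, LinearMap.comp_apply, LinearMap.applyₗ_apply_apply,
    AlgHom.toLinearMap_apply, map_mul, Module.End.mul_apply]
  rw [hx, heckeRep_hGen, heckeOp_of_not_descent h]

variable (T : Type*) [AddCommGroup T] [Module K T]

/-- The coefficient of `h_w` on `T ⊗ Hecke`. -/
def coeffAt (w : Equiv.Perm (Fin d)) : T ⊗[K] Hecke χS χR d →ₗ[K] T :=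
  (TensorProduct.rid K T).toLinearMap ∘ₗ
    LinearMap.lTensor T (Finsupp.lapply w ∘ₗ heckeRepr χS χR)

variable {T}

open scoped Classical in
-- Coefficients are linear functionals on the Hecke algebra, so they survive tensoring with any
-- module `T`; no flatness is needed.
theorem coeffAt_tmul {w w' : Equiv.Perm (Fin d)} {x : Hecke χS χR d}
    (hx : heckeRepr χS χR x = Finsupp.single w' 1) (t : T) :
    coeffAt χS χR T w (t ⊗ₜ x) = if w' = w then t else 0 := by
  simp [coeffAt, hx, Finsupp.single_apply]

end Hecke

/-! ### The operators of the simple transpositions on `M^{⊗ d} ⊗ Hecke` -/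

section RightLinear

variable {K M : Type*} [CommRing K] [AddCommGroup M] [Module K M] {χS χR : K} {d : ℕ}

/-- Right multiplication by an element of the twisted Hecke algebra. -/
def rightMul (M : Type*) [AddCommGroup M] [Module K M] (h : Hecke χS χR d) :
    Module.End K (TPow K d M ⊗[K] Hecke χS χR d) :=
  LinearMap.lTensor (TPow K d M) (LinearMap.mulRight K h)

theorem rightMul_tmul (h x : Hecke χS χR d) (m : TPow K d M) :
    rightMul M h (m ⊗ₜ x) = m ⊗ₜ (x * h) := by
  simp [rightMul]

/-- The vectors `m ⊗ 1` generate the tensor product as a right module over the Hecke algebra. -/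
theorem end_ext_of_commute {A A' : Module.End K (TPow K d M ⊗[K] Hecke χS χR d)}
    (hA : ∀ h, Commute A (rightMul M h)) (hA' : ∀ h, Commute A' (rightMul M h))
    (e : ∀ m, A (m ⊗ₜ 1) = A' (m ⊗ₜ 1)) : A = A' := by
  apply TensorProduct.ext'
  intro m h
  have h1 := LinearMap.congr_fun (hA h).eq (m ⊗ₜ 1)
  have h2 := LinearMap.congr_fun (hA' h).eq (m ⊗ₜ 1)
  rw [Module.End.mul_apply, Module.End.mul_apply, rightMul_tmul, one_mul] at h1 h2
  rw [h1, h2, e]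

theorem extendRight_tmul (t : TPow K d M →ₗ[K] TPow K d M ⊗[K] Hecke χS χR d)
    (m : TPow K d M) (h : Hecke χS χR d) : extendRight t (m ⊗ₜ h) = rightMul M h (t m) := by
  simp only [extendRight, LinearMap.comp_apply, LinearMap.rTensor_tmul, LinearEquiv.coe_coe]
  induction t m with
  | zero => simp
  | add x y hx hy => rw [TensorProduct.add_tmul, map_add, map_add, hx, hy, map_add]
  | tmul m x => simp [rightMul_tmul]

theorem extendRight_tmul_one (t : TPow K d M →ₗ[K] TPow K d M ⊗[K] Hecke χS χR d)
    (m : TPow K d M) : extendRight t (m ⊗ₜ 1) = t m := by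
  rw [extendRight_tmul, rightMul, LinearMap.mulRight_one, LinearMap.lTensor_id,
    LinearMap.id_apply]

theorem commute_extendRight (t : TPow K d M →ₗ[K] TPow K d M ⊗[K] Hecke χS χR d)
    (h : Hecke χS χR d) : Commute (extendRight t) (rightMul M h) := by
  apply TensorProduct.ext'
  intro m x
  rw [Module.End.mul_apply, Module.End.mul_apply, rightMul_tmul, extendRight_tmul,
    extendRight_tmul, rightMul, rightMul, rightMul, LinearMap.mulRight_mul,
    LinearMap.lTensor_comp_apply]

theorem commute_rTensor (f : Module.End K (TPow K d M)) (h : Hecke χS χR d) :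
    Commute (LinearMap.rTensor (Hecke χS χR d) f) (rightMul M h) := by
  apply TensorProduct.ext'
  intro m x
  simp [rightMul_tmul]

end RightLinear

section Operators

variable {K M : Type*} [CommRing K] [AddCommGroup M] [Module K M] {d : ℕ}
  (σM ρM : Module.End K (M ⊗[K] M)) (χS χR : K)

/-- The operator `m ⊗ h ↦ σ_i (m) ⊗ h_i h + ρ_i (m) ⊗ h`. -/
def simpleOp (i : Fin (d - 1)) : Module.End K (TPow K d M ⊗[K] Hecke χS χR d) :=
  extendRight (tauSimple σM ρM χS χR i)

theorem simpleOp_tmul (i : Fin (d - 1)) (m : TPow K d M) (h : Hecke χS χR d) :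
    simpleOp σM ρM χS χR i (m ⊗ₜ h) =
      locEnd i σM m ⊗ₜ (hGen χS χR i * h) + locEnd i ρM m ⊗ₜ h := by
  simp [simpleOp, extendRight_tmul, tauSimple, rightMul_tmul]

theorem commute_simpleOp (i : Fin (d - 1)) (h : Hecke χS χR d) :
    Commute (simpleOp σM ρM χS χR i) (rightMul M h) :=
  commute_extendRight _ _

/-- Turns the recursion for the structure map into a product in an endomorphism monoid, where the
word property applies. -/
theorem tauWord_apply (L : List (Fin (d - 1))) (m : TPow K d M) :
    tauWord σM ρM χS χR L m = (L.map (simpleOp σM ρM χS χR)).prod (m ⊗ₜ 1) := by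
  induction L with
  | nil => rfl
  | cons i L ih =>
    rw [List.map_cons, List.prod_cons, Module.End.mul_apply, ← ih]
    rfl

theorem tau_single (c : ChoiceMap d) (w : Equiv.Perm (Fin d)) (m : TPow K d M) :
    tau σM ρM χS χR c (Finsupp.single w 1 ⊗ₜ m) = tauWord σM ρM χS χR (c.r w) m := by
  simp [tau]

theorem tau_one (c : ChoiceMap d) (m : TPow K d M) :
    tau σM ρM χS χR c (Finsupp.single 1 1 ⊗ₜ m) = m ⊗ₜ 1 := by
  rw [tau_single, c.r_one]
  rfl

theorem eq_of_descent_simple {i j : Fin (d - 1)} (h : Descent j (simple i)) : j = i := by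
  by_contra hne
  have hlt : lo j < hi j := by simp [lo, hi, Fin.lt_def]
  have := simple_lt_simple i hlt (by
    rintro ⟨h1, -⟩
    exact hne (Fin.ext (Fin.mk.inj h1)))
  rw [Descent, simple_inv] at h
  exact lt_asymm h this

/-- Makes the structure map at `s_i` the same for every choice of expressions. -/
theorem isReducedExpr_simple {i : Fin (d - 1)} {L : List (Fin (d - 1))}
    (hL : IsReducedExpr (simple i) L) : L = [i] := by
  have h1 : len (simple i) = 1 := by
    have := len_of_not_descent (not_descent_one i)
    rwa [mul_one, len_one] at this
  obtain ⟨j, rfl⟩ := List.length_eq_one_iff.1 (hL.2.trans h1)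
  rw [eq_of_descent_simple (isReducedExpr_cons.1 hL).1]

theorem tau_simple (c : ChoiceMap d) (i : Fin (d - 1)) (m : TPow K d M) :
    tau σM ρM χS χR c (Finsupp.single (simple i) 1 ⊗ₜ m) =
      simpleOp σM ρM χS χR i (m ⊗ₜ 1) := by
  rw [tau_single, isReducedExpr_simple (c.isReducedExpr _), tauWord_apply]
  simp

theorem heckeRepr_hGen (i : Fin (d - 1)) :
    heckeRepr χS χR (hGen χS χR i) = Finsupp.single (simple i) 1 := by
  simpa using heckeRepr_hGen_mul (heckeRepr_one χS χR) (not_descent_one i)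

theorem simple_ne_one (i : Fin (d - 1)) : simple i ≠ 1 := by
  intro h
  have := simple_lo i
  rw [h] at this
  exact lo_ne_hi i this

variable {χS χR} in
theorem tmul_hGen_add_tmul_one_inj {i : Fin (d - 1)} {x y x' y' : TPow K d M}
    (h : x ⊗ₜ hGen χS χR i + y ⊗ₜ 1 = x' ⊗ₜ[K] hGen χS χR i + y' ⊗ₜ[K] (1 : Hecke χS χR d)) :
    x = x' ∧ y = y' := by
  have h1 := congrArg (coeffAt χS χR (TPow K d M) (simple i)) h
  have h2 := congrArg (coeffAt χS χR (TPow K d M) 1) h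
  simp only [map_add, coeffAt_tmul χS χR (heckeRepr_hGen χS χR i),
    coeffAt_tmul χS χR (heckeRepr_one χS χR), simple_ne_one, (simple_ne_one i).symm, if_true,
    if_false, add_zero, zero_add] at h1 h2
  exact ⟨h1, h2⟩

theorem simpleOp_mul_self_apply (i : Fin (d - 1)) (m : TPow K d M) :
    simpleOp σM ρM χS χR i (simpleOp σM ρM χS χR i (m ⊗ₜ 1)) =
      (χS • (locEnd i σM * locEnd i σM) + locEnd i ρM * locEnd i σM +
          locEnd i σM * locEnd i ρM : Module.End K (TPow K d M)) m ⊗ₜ hGen χS χR i +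
        (χR • (locEnd i σM * locEnd i σM) + locEnd i ρM * locEnd i ρM :
          Module.End K (TPow K d M)) m ⊗ₜ 1 := by
  simp only [simpleOp_tmul, map_add, mul_one, hGen_mul_self, TensorProduct.tmul_add,
    TensorProduct.tmul_smul, TensorProduct.add_tmul, ← TensorProduct.smul_tmul',
    LinearMap.add_apply, LinearMap.smul_apply, Module.End.mul_apply]
  abel

/-- Of the eight terms, only `σ_i ρ_j σ_i` carries `h_i ^ 2`; the quadratic relation spreads it over
the coefficients of `h_i` and `1`, which is where `χ(S)` and `χ(R)` enter (M6) and (M7). -/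
theorem simpleOp_braid_apply (i j : Fin (d - 1)) (m : TPow K d M) :
    simpleOp σM ρM χS χR i (simpleOp σM ρM χS χR j (simpleOp σM ρM χS χR i (m ⊗ₜ 1))) =
      (locEnd i σM * locEnd j σM * locEnd i σM : Module.End K (TPow K d M)) m ⊗ₜ
          (hGen χS χR i * (hGen χS χR j * hGen χS χR i)) +
        (locEnd i ρM * locEnd j σM * locEnd i σM : Module.End K (TPow K d M)) m ⊗ₜ
          (hGen χS χR j * hGen χS χR i) +
        (locEnd i σM * locEnd j σM * locEnd i ρM : Module.End K (TPow K d M)) m ⊗ₜ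
          (hGen χS χR i * hGen χS χR j) +
        (χS • (locEnd i σM * locEnd j ρM * locEnd i σM) +
            locEnd i ρM * locEnd j ρM * locEnd i σM + locEnd i σM * locEnd j ρM * locEnd i ρM :
          Module.End K (TPow K d M)) m ⊗ₜ hGen χS χR i +
        (locEnd i ρM * locEnd j σM * locEnd i ρM : Module.End K (TPow K d M)) m ⊗ₜ
          hGen χS χR j +
        (locEnd i ρM * locEnd j ρM * locEnd i ρM +
            χR • (locEnd i σM * locEnd j ρM * locEnd i σM) :
          Module.End K (TPow K d M)) m ⊗ₜ 1 := by
  simp only [simpleOp_tmul, map_add, mul_one, hGen_mul_self, TensorProduct.tmul_add,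
    TensorProduct.tmul_smul, TensorProduct.add_tmul, ← TensorProduct.smul_tmul',
    LinearMap.add_apply, LinearMap.smul_apply, Module.End.mul_apply]
  abel

theorem perm_ne_of_apply_ne {g g' : Equiv.Perm (Fin d)} (x : Fin d) (h : g x ≠ g' x) : g ≠ g' :=
  fun e => h (e ▸ rfl)

/-- The conditions on `σ`, `ρ` which make the operators at `i` and `j` satisfy the braid
relation. -/
def BraidConditions (i j : Fin (d - 1)) : Prop :=
  (locEnd i σM * locEnd j σM * locEnd i σM : Module.End K (TPow K d M)) =
      locEnd j σM * locEnd i σM * locEnd j σM ∧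
    (locEnd i ρM * locEnd j σM * locEnd i σM : Module.End K (TPow K d M)) =
      locEnd j σM * locEnd i σM * locEnd j ρM ∧
    (locEnd i ρM * locEnd j σM * locEnd i ρM : Module.End K (TPow K d M)) =
      χS • (locEnd j σM * locEnd i ρM * locEnd j σM) +
        locEnd j ρM * locEnd i ρM * locEnd j σM + locEnd j σM * locEnd i ρM * locEnd j ρM ∧
    (locEnd i ρM * locEnd j ρM * locEnd i ρM : Module.End K (TPow K d M)) +
        χR • (locEnd i σM * locEnd j ρM * locEnd i σM) =
      locEnd j ρM * locEnd i ρM * locEnd j ρM +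
        χR • (locEnd j σM * locEnd i ρM * locEnd j σM)

/-- Compares coefficients at the six elements of the subgroup generated by `s_i` and `s_j`. The
longest element and `1` give the two conditions symmetric in `i`, `j`; the other four give the
remaining two conditions in both orders. -/
theorem braidConditions_of_simpleOp {i j : Fin (d - 1)} (hij : (i : ℕ) + 1 = j)
    (h : ∀ m : TPow K d M,
      simpleOp σM ρM χS χR i (simpleOp σM ρM χS χR j (simpleOp σM ρM χS χR i (m ⊗ₜ 1))) =
      simpleOp σM ρM χS χR j (simpleOp σM ρM χS χR i (simpleOp σM ρM χS χR j (m ⊗ₜ 1)))) :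
    BraidConditions σM ρM χS χR i j ∧ BraidConditions σM ρM χS χR j i := by
  have r1 := heckeRepr_one (d := d) χS χR
  have ri := heckeRepr_hGen_mul r1 (not_descent_one i)
  have rj := heckeRepr_hGen_mul r1 (not_descent_one j)
  have nij : ¬ Descent i (simple j * 1) := by
    rw [descent_simple_succ_mul hij]
    simp [lo, hi, Fin.lt_def]
    omega
  have nji : ¬ Descent j (simple i * 1) := by
    rw [descent_succ_simple_mul hij]
    simp [lo, hi, Fin.lt_def]
    omega
  have rij := heckeRepr_hGen_mul rj nij
  have rji := heckeRepr_hGen_mul ri nji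
  have riji := heckeRepr_hGen_mul rji (by
    rw [descent_simple_succ_mul_simple_mul hij]
    exact not_descent_one j)
  have rjij := heckeRepr_hGen_mul rij (by
    rw [descent_succ_simple_mul_simple_succ_mul hij]
    exact not_descent_one i)
  -- Both braid words now expand to the same basis vector.
  rw [← simple_braid_mul hij] at rjij
  simp only [mul_one] at ri rj rij rji riji rjij
  have a1 := simple_lo i
  have a2 := simple_apply_lo_succ hij
  have a3 := simple_apply_hi_succ hij
  have b1 := simple_succ_apply_lo hij
  have b2 := simple_lo j
  have b3 := simple_hi j
  have e := hi_eq_lo hij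
  have n1 := lo_ne_hi i
  have n2 := lo_ne_hi j
  have n3 : lo i ≠ hi j := by simp [lo, hi]; omega
  rw [e] at a1 n1
  have key : ∀ (g : Equiv.Perm (Fin d)) (m : TPow K d M), _ := fun g m =>
    congrArg (coeffAt χS χR (TPow K d M) g) (h m)
  simp only [simpleOp_braid_apply, map_add, coeffAt_tmul χS χR r1, coeffAt_tmul χS χR ri,
    coeffAt_tmul χS χR rj, coeffAt_tmul χS χR rij, coeffAt_tmul χS χR rji,
    coeffAt_tmul χS χR riji, coeffAt_tmul χS χR rjij] at key
  -- The fifteen inequalities separate all pairs among the six elements, by cancellation or by the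
  -- image of `lo i`.
  have d1 : simple i ≠ 1 := simple_ne_one i
  have d2 : simple j ≠ 1 := simple_ne_one j
  have d3 : simple i ≠ simple j := perm_ne_of_apply_ne (lo i) (by simp [*, n1.symm])
  have d4 : simple i * simple j ≠ 1 := perm_ne_of_apply_ne (lo i) (by simp [*, n1.symm])
  have d5 : simple j * simple i ≠ 1 := perm_ne_of_apply_ne (lo i) (by simp [*, n3.symm])
  have d6 : simple i * (simple j * simple i) ≠ 1 :=
    perm_ne_of_apply_ne (lo i) (by simp [*, n3.symm])
  have d7 : simple i * simple j ≠ simple i := by simp [d2]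
  have d8 : simple i * simple j ≠ simple j := by simp [d1]
  have d9 : simple j * simple i ≠ simple i := by simp [d2]
  have d10 : simple j * simple i ≠ simple j := by simp [d1]
  have d11 : simple i * (simple j * simple i) ≠ simple i := by simp [d5]
  have d12 : simple i * (simple j * simple i) ≠ simple j :=
    perm_ne_of_apply_ne (lo i) (by simp [*, n3.symm])
  have d13 : simple i * simple j ≠ simple j * simple i :=
    perm_ne_of_apply_ne (lo i) (by simp [*])
  have d14 : simple i * (simple j * simple i) ≠ simple i * simple j := by simp [d1]
  have d15 : simple i * (simple j * simple i) ≠ simple j * simple i := by simp [d1]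
  have k1 := fun m => key 1 m
  have k2 := fun m => key (simple i) m
  have k3 := fun m => key (simple j) m
  have k4 := fun m => key (simple i * simple j) m
  have k5 := fun m => key (simple j * simple i) m
  have k6 := fun m => key (simple i * (simple j * simple i)) m
  simp only [d1, d2, d3, d4, d5, d6, d7, d8, d9, d10, d11, d12, d13, d14, d15, d1.symm, d2.symm,
    d3.symm, d4.symm, d5.symm, d6.symm, d7.symm, d8.symm, d9.symm, d10.symm, d11.symm, d12.symm,
    d13.symm, d14.symm, d15.symm, if_true, if_false, add_zero, zero_add] at k1 k2 k3 k4 k5 k6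
  refine ⟨⟨LinearMap.ext k6, LinearMap.ext k5, LinearMap.ext k3, LinearMap.ext k1⟩,
    ⟨LinearMap.ext fun m => (k6 m).symm, LinearMap.ext fun m => (k4 m).symm,
      LinearMap.ext fun m => (k2 m).symm, LinearMap.ext fun m => (k1 m).symm⟩⟩

theorem simpleOp_braid_of_braidConditions {i j : Fin (d - 1)} (hij : (i : ℕ) + 1 = j)
    (h : BraidConditions σM ρM χS χR i j) (h' : BraidConditions σM ρM χS χR j i) :
    simpleOp σM ρM χS χR i * simpleOp σM ρM χS χR j * simpleOp σM ρM χS χR i =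
      simpleOp σM ρM χS χR j * simpleOp σM ρM χS χR i * simpleOp σM ρM χS χR j := by
  have ci := commute_simpleOp σM ρM χS χR i
  have cj := commute_simpleOp σM ρM χS χR j
  refine end_ext_of_commute (fun h => ((ci h).mul_left (cj h)).mul_left (ci h))
    (fun h => ((cj h).mul_left (ci h)).mul_left (cj h)) fun m => ?_
  have hb := (braidFamily_H (heckeParams χS χR)).braid i j hij
  simp only [mul_assoc] at hb
  have hb' : hGen χS χR i * (hGen χS χR j * hGen χS χR i) =
    hGen χS χR j * (hGen χS χR i * hGen χS χR j) := hb
  rw [Module.End.mul_apply, Module.End.mul_apply, Module.End.mul_apply, Module.End.mul_apply,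
    simpleOp_braid_apply, simpleOp_braid_apply, h.1, h.2.1, h.2.2.1, h.2.2.2, h'.2.1, h'.2.2.1,
    hb']
  abel

theorem braidFamily_simpleOp (h : ∀ i j : Fin (d - 1), Adjacent i j →
    BraidConditions σM ρM χS χR i j) :
    BraidFamily (simpleOp σM ρM χS χR :
      Fin (d - 1) → Module.End K (TPow K d M ⊗[K] Hecke χS χR d)) where
  braid i j hij := simpleOp_braid_of_braidConditions σM ρM χS χR hij (h i j (Or.inl hij))
    (h j i (Or.inr hij))
  comm i j hij := by
    have hc : ∀ φ ψ : Module.End K (M ⊗[K] M), ∀ m : TPow K d M,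
        locEnd i φ (locEnd j ψ m) = locEnd j ψ (locEnd i φ m) := fun φ ψ m =>
      LinearMap.congr_fun (locEnd_comm i j hij φ ψ) m
    have hh : hGen χS χR i * hGen χS χR j = hGen χS χR j * hGen χS χR i :=
      (braidFamily_H (heckeParams χS χR)).comm i j hij
    apply TensorProduct.ext'
    intro m x
    simp only [Module.End.mul_apply, simpleOp_tmul, map_add, hc, ← mul_assoc, hh]
    abel

end Operators

/-! ### The two diagrams on elements -/

section Diagrams

variable {K B M : Type*} [CommRing K] [Ring B] [Algebra K B]
  [AddCommGroup M] [Module K M] [Module B M] [IsScalarTower K B M] {d : ℕ} {χS χR : K}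

/-- The map `(α_M ⊗ 1) ∘ (1 ⊗ t)` on `(B^{⊗ d} ⊗ W) ⊗ M^{⊗ d}`. -/
def actAfter (B : Type*) [Ring B] [Algebra K B] [Module B M] [IsScalarTower K B M]
    (t : W K d ⊗[K] TPow K d M →ₗ[K] TPow K d M ⊗[K] Hecke χS χR d) :
    (TPow K d B ⊗[K] W K d) ⊗[K] TPow K d M →ₗ[K] TPow K d M ⊗[K] Hecke χS χR d :=
  LinearMap.rTensor (Hecke χS χR d) (actT K B M d) ∘ₗ
    (TensorProduct.assoc K (TPow K d B) (TPow K d M) (Hecke χS χR d)).symm.toLinearMap ∘ₗ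
      LinearMap.lTensor (TPow K d B) t ∘ₗ
        (TensorProduct.assoc K (TPow K d B) (W K d) (TPow K d M)).toLinearMap

theorem actAfter_tmul (t : W K d ⊗[K] TPow K d M →ₗ[K] TPow K d M ⊗[K] Hecke χS χR d)
    (b : TPow K d B) (w : W K d) (m : TPow K d M) :
    actAfter B t ((b ⊗ₜ w) ⊗ₜ m) =
      LinearMap.rTensor (Hecke χS χR d) (act K B M d b) (t (w ⊗ₜ m)) := by
  simp only [actAfter, LinearMap.comp_apply, LinearEquiv.coe_coe, TensorProduct.assoc_tmul,
    LinearMap.lTensor_tmul]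
  induction t (w ⊗ₜ m) with
  | zero => simp
  | add x y hx hy => rw [TensorProduct.tmul_add, map_add, map_add, hx, hy, map_add]
  | tmul m h => simp [actT]

/-- For a fixed first factor, the left side of (WW) is the right-linear extension of the structure
map at that factor. -/
theorem mul_after_eq_extendRight
    (t : W K d ⊗[K] TPow K d M →ₗ[K] TPow K d M ⊗[K] Hecke χS χR d)
    (w : W K d) (z : TPow K d M ⊗[K] Hecke χS χR d) :
    LinearMap.lTensor (TPow K d M) (LinearMap.mul' K (Hecke χS χR d))
      (TensorProduct.assoc K (TPow K d M) (Hecke χS χR d) (Hecke χS χR d)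
        (LinearMap.rTensor (Hecke χS χR d) t
          ((TensorProduct.assoc K (W K d) (TPow K d M) (Hecke χS χR d)).symm (w ⊗ₜ z)))) =
      extendRight (t ∘ₗ TensorProduct.mk K (W K d) (TPow K d M) w) z := by
  induction z with
  | zero => simp
  | add x y hx hy =>
    rw [TensorProduct.tmul_add, map_add, map_add, map_add, map_add, hx, hy, map_add]
  | tmul m h => simp [extendRight]

variable {Q : Params K B} (hPBW : HasPBWBasis Q d)

theorem pbwEquiv_tmul_single (b : TPow K d B) (w : Equiv.Perm (Fin d)) :
    pbwEquiv hPBW (b ⊗ₜ Finsupp.single w 1) = ofBase Q d b * HW Q w := by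
  simp [pbwEquiv, normalForm, ofW]

theorem tauB_single (w : Equiv.Perm (Fin d)) (b : TPow K d B) :
    tauB hPBW (Finsupp.single w 1 ⊗ₜ b) = (pbwEquiv hPBW).symm (HW Q w * ofBase Q d b) := by
  simp [tauB, ofW]

theorem mulW_single (w x : Equiv.Perm (Fin d)) :
    mulW hPBW (Finsupp.single w 1 ⊗ₜ Finsupp.single x 1) =
      (pbwEquiv hPBW).symm (HW Q w * HW Q x) := by
  simp [mulW, ofW]

theorem single_tmul_tmul_ext {N P V : Type*} [AddCommGroup N] [Module K N] [AddCommGroup P]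
    [Module K P] [AddCommGroup V] [Module K V] {f g : (W K d ⊗[K] N) ⊗[K] P →ₗ[K] V}
    (h : ∀ (w : Equiv.Perm (Fin d)) (n : N) (p : P),
      f ((Finsupp.single w 1 ⊗ₜ n) ⊗ₜ p) = g ((Finsupp.single w 1 ⊗ₜ n) ⊗ₜ p)) : f = g := by
  apply TensorProduct.ext_threefold
  intro x n p
  induction x using Finsupp.induction_linear with
  | zero => simp only [TensorProduct.zero_tmul, map_zero]
  | add x y hx hy => rw [TensorProduct.add_tmul, TensorProduct.add_tmul, map_add, map_add, hx, hy]
  | single w k =>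
    rw [← mul_one k, ← smul_eq_mul, ← Finsupp.smul_single, ← TensorProduct.smul_tmul',
      ← TensorProduct.smul_tmul', map_smul, map_smul, h]

theorem diagramWB_iff (t : W K d ⊗[K] TPow K d M →ₗ[K] TPow K d M ⊗[K] Hecke χS χR d) :
    DiagramWB hPBW t ↔ ∀ (w : Equiv.Perm (Fin d)) (b : TPow K d B) (m : TPow K d M),
      t (Finsupp.single w 1 ⊗ₜ act K B M d b m) =
        actAfter B t ((pbwEquiv hPBW).symm (HW Q w * ofBase Q d b) ⊗ₜ m) := by
  constructor
  · intro h w b m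
    have := LinearMap.congr_fun h ((Finsupp.single w 1 ⊗ₜ b) ⊗ₜ m)
    simp only [LinearMap.comp_apply, LinearEquiv.coe_coe, TensorProduct.assoc_tmul,
      LinearMap.lTensor_tmul, LinearMap.rTensor_tmul, actT, TensorProduct.lift.tmul,
      tauB_single] at this
    exact this
  · intro h
    apply single_tmul_tmul_ext
    intro w b m
    simp only [LinearMap.comp_apply, LinearEquiv.coe_coe, TensorProduct.assoc_tmul,
      LinearMap.lTensor_tmul, LinearMap.rTensor_tmul, actT, TensorProduct.lift.tmul,
      tauB_single]
    exact h w b m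

theorem diagramWW_iff (t : W K d ⊗[K] TPow K d M →ₗ[K] TPow K d M ⊗[K] Hecke χS χR d) :
    DiagramWW hPBW t ↔ ∀ (w x : Equiv.Perm (Fin d)) (m : TPow K d M),
      extendRight (t ∘ₗ TensorProduct.mk K (W K d) (TPow K d M) (Finsupp.single w 1))
          (t (Finsupp.single x 1 ⊗ₜ m)) =
        actAfter B t ((pbwEquiv hPBW).symm (HW Q w * HW Q x) ⊗ₜ m) := by
  constructor
  · intro h w x m
    have := LinearMap.congr_fun h ((Finsupp.single w 1 ⊗ₜ Finsupp.single x 1) ⊗ₜ m)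
    simp only [LinearMap.comp_apply, LinearEquiv.coe_coe, TensorProduct.assoc_tmul,
      LinearMap.lTensor_tmul, LinearMap.rTensor_tmul, mul_after_eq_extendRight,
      mulW_single] at this
    exact this
  · intro h
    apply single_tmul_tmul_ext
    intro w x m
    induction x using Finsupp.induction_linear with
    | zero => simp only [TensorProduct.tmul_zero, TensorProduct.zero_tmul, map_zero]
    | add x y hx hy => rw [TensorProduct.tmul_add, TensorProduct.add_tmul, map_add, map_add, hx, hy]
    | single x k =>
    rw [← mul_one k, ← smul_eq_mul, ← Finsupp.smul_single, TensorProduct.tmul_smul,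
      ← TensorProduct.smul_tmul', map_smul, map_smul]
    congr 1
    simp only [LinearMap.comp_apply, LinearEquiv.coe_coe, TensorProduct.assoc_tmul,
      LinearMap.lTensor_tmul, LinearMap.rTensor_tmul, mul_after_eq_extendRight,
      mulW_single]
    exact h w x m

end Diagrams

/-! ### Necessity of the conditions -/

section Necessity

variable {K B M : Type*} [CommRing K] [Ring B] [Algebra K B]
  [AddCommGroup M] [Module K M] [Module B M] [IsScalarTower K B M] {d : ℕ} {χS χR : K}
  {Q : Params K B} {hPBW : HasPBWBasis Q d} {σM ρM : Module.End K (M ⊗[K] M)} {c : ChoiceMap d}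

/-- At `w = s_i` the wreath relation already is the normal form of `H_i b`, so (WB) can be compared
at `h_i` and at `1`. -/
theorem condM2_of_diagramWB (h : DiagramWB hPBW (tau σM ρM χS χR c)) :
    CondM2 Q d σM ρM := by
  intro i b m
  have h1 := (diagramWB_iff hPBW _).1 h (simple i) b m
  have h2 : (pbwEquiv hPBW).symm (HW Q (simple i) * ofBase Q d b) =
      locEnd i Q.σ b ⊗ₜ Finsupp.single (simple i) 1 + locEnd i Q.ρ b ⊗ₜ Finsupp.single 1 1 := by
    rw [LinearEquiv.symm_apply_eq, map_add, pbwEquiv_tmul_single, pbwEquiv_tmul_single,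
      HW_simple, HW_one, mul_one, H_mul_ofBase]
  rw [h2, TensorProduct.add_tmul, map_add, actAfter_tmul, actAfter_tmul, tau_simple, tau_simple,
    tau_one, simpleOp_tmul, simpleOp_tmul, mul_one, map_add, LinearMap.rTensor_tmul,
    LinearMap.rTensor_tmul, LinearMap.rTensor_tmul, add_assoc, ← TensorProduct.add_tmul] at h1
  exact tmul_hGen_add_tmul_one_inj h1

theorem extendRight_tau_simple (i : Fin (d - 1)) :
    extendRight (tau σM ρM χS χR c ∘ₗ
      TensorProduct.mk K (W K d) (TPow K d M) (Finsupp.single (simple i) 1)) =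
      simpleOp σM ρM χS χR i := by
  refine end_ext_of_commute (commute_extendRight _) (commute_simpleOp σM ρM χS χR i) fun m => ?_
  rw [extendRight_tmul_one, LinearMap.comp_apply, TensorProduct.mk_apply, tau_simple]

/-- The same comparison for (WW) at `(s_i, s_i)`, where the quadratic relation is the normal form of
`H_i ^ 2`. -/
theorem condM4_of_diagramWW (h : DiagramWW hPBW (tau σM ρM χS χR c)) :
    CondM4 Q d σM ρM χS χR := by
  intro i
  have key : ∀ m : TPow K d M,
      (χS • (locEnd i σM * locEnd i σM) + locEnd i ρM * locEnd i σM +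
          locEnd i σM * locEnd i ρM : Module.End K (TPow K d M)) m =
        act K B M d (locElt i Q.S) (locEnd i σM m) ∧
      (χR • (locEnd i σM * locEnd i σM) + locEnd i ρM * locEnd i ρM :
          Module.End K (TPow K d M)) m =
        act K B M d (locElt i Q.S) (locEnd i ρM m) + act K B M d (locElt i Q.R) m := fun m => by
    have h1 := (diagramWW_iff hPBW _).1 h (simple i) (simple i) m
    have h2 : (pbwEquiv hPBW).symm (HW Q (simple i) * HW Q (simple i)) =
        locElt i Q.S ⊗ₜ Finsupp.single (simple i) 1 + locElt i Q.R ⊗ₜ Finsupp.single 1 1 := by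
      rw [LinearEquiv.symm_apply_eq, map_add, pbwEquiv_tmul_single, pbwEquiv_tmul_single,
        HW_simple, HW_one, mul_one, H_mul_self]
    rw [h2, extendRight_tau_simple, TensorProduct.add_tmul, map_add, actAfter_tmul,
      actAfter_tmul, tau_simple, tau_one, simpleOp_mul_self_apply, simpleOp_tmul, mul_one, map_add,
      LinearMap.rTensor_tmul, LinearMap.rTensor_tmul, LinearMap.rTensor_tmul] at h1
    exact tmul_hGen_add_tmul_one_inj (h1.trans (by rw [TensorProduct.add_tmul, add_assoc]))
  exact ⟨LinearMap.ext fun m => (key m).1, LinearMap.ext fun m => (key m).2⟩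

/-- Here `H_i H_w` is a single standard element with coefficient `1`. Hence (WW) extends the
recursion to every length-increasing `s_i`, not only the one selected by `c`. -/
theorem simpleOp_tau (h : DiagramWW hPBW (tau σM ρM χS χR c)) {i : Fin (d - 1)}
    {w : Equiv.Perm (Fin d)} (hw : ¬ Descent i w) (m : TPow K d M) :
    simpleOp σM ρM χS χR i (tau σM ρM χS χR c (Finsupp.single w 1 ⊗ₜ m)) =
      tau σM ρM χS χR c (Finsupp.single (simple i * w) 1 ⊗ₜ m) := by
  have h1 := (diagramWW_iff hPBW _).1 h (simple i) w m
  have h2 : (pbwEquiv hPBW).symm (HW Q (simple i) * HW Q w) =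
      1 ⊗ₜ Finsupp.single (simple i * w) 1 := by
    rw [LinearEquiv.symm_apply_eq, pbwEquiv_tmul_single, HW_simple, map_one, one_mul,
      H_mul_HW Q hw]
  rwa [h2, extendRight_tau_simple, actAfter_tmul, act_one, LinearMap.rTensor_id,
    LinearMap.id_apply] at h1

/-- Both braid words climb from `1` in length-increasing steps to the same permutation, hence to the
same value of the structure map. -/
theorem braidConditions_of_diagramWW (h : DiagramWW hPBW (tau σM ρM χS χR c))
    {i j : Fin (d - 1)} (hij : (i : ℕ) + 1 = j) :
    BraidConditions σM ρM χS χR i j ∧ BraidConditions σM ρM χS χR j i := by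
  refine braidConditions_of_simpleOp σM ρM χS χR hij fun m => ?_
  have hlt := not_lt_of_not_descent hij (not_descent_one i) (not_descent_one j)
  have hij1 : ¬ Descent i (simple j * (1 : Equiv.Perm (Fin d))) := by
    rwa [descent_simple_succ_mul hij]
  have hji1 : ¬ Descent j (simple i * (1 : Equiv.Perm (Fin d))) := by
    rwa [descent_succ_simple_mul hij]
  have hiji : ¬ Descent i (simple j * (simple i * (1 : Equiv.Perm (Fin d)))) := by
    rw [descent_simple_succ_mul_simple_mul hij]
    exact not_descent_one j
  have hjij : ¬ Descent j (simple i * (simple j * (1 : Equiv.Perm (Fin d)))) := by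
    rw [descent_succ_simple_mul_simple_succ_mul hij]
    exact not_descent_one i
  rw [← tau_one σM ρM χS χR c, simpleOp_tau h (not_descent_one i),
    simpleOp_tau h (not_descent_one j), simpleOp_tau h hji1, simpleOp_tau h hij1,
    simpleOp_tau h hiji, simpleOp_tau h hjij, simple_braid_mul hij]

end Necessity

/-! ### Sufficiency of the conditions -/

section Sufficiency

variable {K B M : Type*} [CommRing K] [Ring B] [Algebra K B]
  [AddCommGroup M] [Module K M] [Module B M] [IsScalarTower K B M] {d : ℕ}

/-- The representation of `B^{⊗ d}` on `M^{⊗ d} ⊗ Hecke`. -/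
def baseRep (K B M : Type*) [CommRing K] [Ring B] [Algebra K B] [AddCommGroup M] [Module K M]
    [Module B M] [IsScalarTower K B M] (d : ℕ) (χS χR : K) :
    TPow K d B →ₐ[K] Module.End K (TPow K d M ⊗[K] Hecke χS χR d) :=
  (Module.End.rTensorAlgHom K (TPow K d M) (Hecke χS χR d)).comp
    (AlgHom.ofLinearMap (act K B M d : TPow K d B →ₗ[K] Module.End K (TPow K d M)) act_one
      act_mul)

variable {χS χR : K}

theorem baseRep_apply (b : TPow K d B) :
    baseRep K B M d χS χR b = LinearMap.rTensor (Hecke χS χR d) (act K B M d b) := rfl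

variable {Q : Params K B} {hPBW : HasPBWBasis Q d} {σM ρM : Module.End K (M ⊗[K] M)}

theorem simpleOp_mul_self (h : CondM4 Q d σM ρM χS χR) (i : Fin (d - 1)) :
    simpleOp σM ρM χS χR i * simpleOp σM ρM χS χR i =
      baseRep K B M d χS χR (locElt i Q.S) * simpleOp σM ρM χS χR i +
        baseRep K B M d χS χR (locElt i Q.R) := by
  have ci := commute_simpleOp σM ρM χS χR i
  refine end_ext_of_commute (fun h => (ci h).mul_left (ci h))
    (fun h => ((commute_rTensor _ h).mul_left (ci h)).add_left (commute_rTensor _ h)) fun m => ?_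
  rw [Module.End.mul_apply, simpleOp_mul_self_apply, (h i).1, (h i).2]
  simp only [LinearMap.add_apply, Module.End.mul_apply, simpleOp_tmul, baseRep_apply, map_add,
    LinearMap.rTensor_tmul, TensorProduct.add_tmul, mul_one, add_assoc]

theorem simpleOp_mul_baseRep (h : CondM2 Q d σM ρM) (i : Fin (d - 1)) (b : TPow K d B) :
    simpleOp σM ρM χS χR i * baseRep K B M d χS χR b =
      baseRep K B M d χS χR (locEnd i Q.σ b) * simpleOp σM ρM χS χR i +
        baseRep K B M d χS χR (locEnd i Q.ρ b) := by
  apply TensorProduct.ext'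
  intro m x
  simp only [LinearMap.add_apply, Module.End.mul_apply, simpleOp_tmul, baseRep_apply, map_add,
    LinearMap.rTensor_tmul, TensorProduct.add_tmul, (h i b m).1, (h i b m).2, add_assoc]

/-- The action of `B ≀ H(d)` on `M^{⊗ d} ⊗ Hecke`. -/
def wreathRep (h2 : CondM2 Q d σM ρM) (h4 : CondM4 Q d σM ρM χS χR)
    (hb : ∀ i j : Fin (d - 1), Adjacent i j → BraidConditions σM ρM χS χR i j) :
    QWP Q d →ₐ[K] Module.End K (TPow K d M ⊗[K] Hecke χS χR d) :=
  liftHom Q (baseRep K B M d χS χR) (simpleOp σM ρM χS χR)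
    (braidFamily_simpleOp σM ρM χS χR hb)
    (fun i => simpleOp_mul_self h4 i)
    (fun i b => by exact simpleOp_mul_baseRep h2 i b)

section

variable (h2 : CondM2 Q d σM ρM) (h4 : CondM4 Q d σM ρM χS χR)
    (hb : ∀ i j : Fin (d - 1), Adjacent i j → BraidConditions σM ρM χS χR i j)

theorem wreathRep_ofBase (b : TPow K d B) :
    wreathRep h2 h4 hb (ofBase Q d b) = baseRep K B M d χS χR b :=
  liftHom_ofBase ..

theorem wreathRep_HW (w : Equiv.Perm (Fin d)) :
    wreathRep h2 h4 hb (HW Q w) = redProd (simpleOp σM ρM χS χR) w := by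
  rw [HW, map_list_prod, List.map_map, redProd]
  congr 2
  funext i
  exact liftHom_H ..

/-- The right side does not involve `c`: this is independence of the choice. -/
theorem tau_eq_wreathRep (c : ChoiceMap d) (w : Equiv.Perm (Fin d)) (m : TPow K d M) :
    tau σM ρM χS χR c (Finsupp.single w 1 ⊗ₜ m) = wreathRep h2 h4 hb (HW Q w) (m ⊗ₜ 1) := by
  rw [tau_single, tauWord_apply, wreathRep_HW,
    (braidFamily_simpleOp σM ρM χS χR hb).prod_eq_redProd (c.isReducedExpr w)]

/-- On `b ⊗ w` both sides are `b · (H_w · (m ⊗ 1))`. This undoes the inverse PBW identification on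
the right of both diagrams. -/
theorem actAfter_tau (c : ChoiceMap d) (y : TPow K d B ⊗[K] W K d) (m : TPow K d M) :
    actAfter B (tau σM ρM χS χR c) (y ⊗ₜ m) =
      wreathRep h2 h4 hb (pbwEquiv hPBW y) (m ⊗ₜ 1) := by
  induction y with
  | zero => simp only [TensorProduct.zero_tmul, map_zero, LinearMap.zero_apply]
  | add x y hx hy => rw [TensorProduct.add_tmul, map_add, hx, hy, map_add, map_add,
      LinearMap.add_apply]
  | tmul b x =>
    induction x using Finsupp.induction_linear with
    | zero => simp only [TensorProduct.tmul_zero, TensorProduct.zero_tmul, map_zero,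
        LinearMap.zero_apply]
    | add x y hx hy => rw [TensorProduct.tmul_add, TensorProduct.add_tmul, map_add, hx, hy,
        map_add, map_add, LinearMap.add_apply]
    | single w k =>
      rw [← mul_one k, ← smul_eq_mul, ← Finsupp.smul_single, TensorProduct.tmul_smul,
        ← TensorProduct.smul_tmul', map_smul, map_smul, map_smul, LinearMap.smul_apply,
        actAfter_tmul, pbwEquiv_tmul_single, map_mul, Module.End.mul_apply,
        tau_eq_wreathRep h2 h4 hb, wreathRep_ofBase, baseRep_apply]

theorem extendRight_tau (c : ChoiceMap d) (w : Equiv.Perm (Fin d)) :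
    extendRight (tau σM ρM χS χR c ∘ₗ
      TensorProduct.mk K (W K d) (TPow K d M) (Finsupp.single w 1)) =
      wreathRep h2 h4 hb (HW Q w) := by
  refine end_ext_of_commute (commute_extendRight _) (fun h => ?_) fun m => ?_
  · rw [wreathRep_HW]
    refine Commute.list_prod_left _ _ fun A hA => ?_
    obtain ⟨i, -, rfl⟩ := List.mem_map.1 hA
    exact commute_simpleOp σM ρM χS χR i h
  · rw [extendRight_tmul_one, LinearMap.comp_apply, TensorProduct.mk_apply,
      tau_eq_wreathRep h2 h4 hb]

-- The diagrams reduce to `H_w · (b · (m ⊗ 1)) = (H_w b) · (m ⊗ 1)` and `H_w · (H_x · (m ⊗ 1)) =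
-- (H_w H_x) · (m ⊗ 1)`.
include h2 h4 hb in
theorem isGroundModule_of_conditions : IsGroundModule hPBW σM ρM χS χR where
  indep c c' := by
    apply TensorProduct.ext
    apply Finsupp.lhom_ext'
    intro w
    apply LinearMap.ext_ring
    apply LinearMap.ext
    intro m
    exact (tau_eq_wreathRep h2 h4 hb c w m).trans (tau_eq_wreathRep h2 h4 hb c' w m).symm
  wb c := by
    rw [diagramWB_iff]
    intro w b m
    rw [actAfter_tau (hPBW := hPBW) h2 h4 hb, LinearEquiv.apply_symm_apply, tau_eq_wreathRep h2 h4 hb, map_mul,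
      Module.End.mul_apply, wreathRep_ofBase, baseRep_apply, LinearMap.rTensor_tmul]
  ww c := by
    rw [diagramWW_iff]
    intro w x m
    rw [actAfter_tau (hPBW := hPBW) h2 h4 hb, LinearEquiv.apply_symm_apply, tau_eq_wreathRep h2 h4 hb, map_mul,
      Module.End.mul_apply, extendRight_tau h2 h4 hb]

end

theorem braidConditions_iff :
    (∀ i j : Fin (d - 1), Adjacent i j → BraidConditions σM ρM χS χR i j) ↔
      (3 ≤ d → CondM5 d σM ρM ∧ CondM6 d σM ρM χS ∧ CondM7 d σM ρM χR) := by
  constructor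
  · intro h _
    exact ⟨fun i j hij => ⟨(h i j hij).1, (h i j hij).2.1⟩, fun i j hij => (h i j hij).2.2.1,
      fun i j hij => (h i j hij).2.2.2⟩
  · intro h i j hij
    -- Two adjacent indices below `d - 1` force `d ≥ 3`; for `d = 2` there is no braid condition.
    obtain ⟨h5, h6, h7⟩ := h (by
      have := i.2
      have := j.2
      rcases hij with hij | hij <;> omega)
    exact ⟨(h5 i j hij).1, (h5 i j hij).2, h6 i j hij, h7 i j hij⟩

end Sufficiency

end QuantumWreath

end

theorem theorem4 {K B M : Type*} [CommRing K] [Ring B] [Algebra K B]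
    [AddCommGroup M] [Module K M] [Module B M] [IsScalarTower K B M]
    (d : ℕ) (hd : 2 ≤ d)
    (Q : QuantumWreath.Params K B) (hPBW : QuantumWreath.HasPBWBasis Q d)
    (σM ρM : Module.End K (TensorProduct K M M)) (χS χR : K) :
    QuantumWreath.IsGroundModule hPBW σM ρM χS χR ↔
      (QuantumWreath.CondM2 Q d σM ρM ∧ QuantumWreath.CondM4 Q d σM ρM χS χR) ∧
      (3 ≤ d →
        QuantumWreath.CondM5 d σM ρM ∧ QuantumWreath.CondM6 d σM ρM χS ∧
          QuantumWreath.CondM7 d σM ρM χR) := by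
  rw [← QuantumWreath.braidConditions_iff]
  constructor
  · intro h
    obtain ⟨c⟩ := QuantumWreath.nonempty_choiceMap (d := d)
    refine ⟨⟨QuantumWreath.condM2_of_diagramWB (h.wb c),
      QuantumWreath.condM4_of_diagramWW (h.ww c)⟩, fun i j hij => ?_⟩
    rcases hij with hij | hij
    · exact (QuantumWreath.braidConditions_of_diagramWW (h.ww c) hij).1
    · exact (QuantumWreath.braidConditions_of_diagramWW (h.ww c) hij).2
  · rintro ⟨⟨h2, h4⟩, hb⟩
    exact QuantumWreath.isGroundModule_of_conditions h2 h4 hb
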